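/- Notation. $\mathbb H$ is the skew field of quaternions, $\mathbb S^2$ the sphere of imaginary units, $\mathbb C(\mathbf i)=\mathbb R+\mathbb R\mathbf i$ for $\mathbf i\in\mathbb S^2$, $\mathbb B$ the open unit ball of $\mathbb H$, $\mathbb E=\mathbb B\setminus(-1,0]$, $\mathbb B_{\mathbf i}=\mathbb B\cap\mathbb C(\mathbf i)$, $\mathbb E_{\mathbf i}=\mathbb E\cap\mathbb C(\mathbf i)$, and $\mu_{\mathbf i}$ is the area measure of $\mathbb C(\mathbf i)$. For $q=x+yI_q$ with $I_q\in\mathbb S^2$, $y\ge 0$, put $q^{a}=\exp\big(a(\ln|q|+I_q\operatorname{Arg}q)\big)$. Put $e_k(q)=\sum_{n=0}^k q^n/n!$ for $k\in\mathbb N$ and $e_\infty(q)=e^q$. $\mathcal{SR}(\mathbb B)$ is the set of slice regular functions on $\mathbb B$ (real differentiable, $(\partial_x+I\partial_y)f=0$ on $\mathbb B\cap\mathbb C(I)$ for all $I\in\mathbb S^2$), $f'=\partial f/\partial x$ is the slice derivative, and $\ast$, ${}^{-\ast}$ are the slice regular product and inverse. The $\mathbf i$-slice regular Bergman space of $\mathbb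 B_{\mathbf i}$ consists of the $g\in\mathcal{SR}(\mathbb B)$ with $\int_{\mathbb B_{\mathbf i}}|g|^2\,d\mu_{\mathbf i}<\infty$. The slice regular Bergman kernel $\mathcal B_{\mathbf i}(q,\zeta)$, $\zeta\in\mathbb B_{\mathbf i}$, is the slice regular extension in $q$ to $\mathbb B$ of the Bergman kernel $\frac1{\pi(1-z\bar\zeta)^2}$ of the disc $\mathbb B_{\mathbf i}$. The $\mathbf i$-fractal-fractional derivative of $f$ is, for $z\in\mathbb E_{\mathbf i}$, $$\frac{d^\sigma}{dq_{\alpha,k,\mathbf i}}f(z)=(1-\sigma)f(z)+\sigma\lim_{\mathbb E_{\mathbf i}\ni\zeta\to z}\big(e_k(z^\alpha)-e_k(\zeta^\alpha)\big)^{-1}\big(f(z)-f(\zeta)\big).$$ Corollary (reproducing property). Let $\sigma\in(0,1)$, $\alpha\in(0,1]$, $k\in\{1,2,\dots\}\cup\{\infty\}$ with $e_{k-1}(q^\alpha)\ne0$ for all $q\in\mathbb E$ (where $e_{\infty-1}=e_\infty$), and let $\mathbf i\in\mathbb S^2$. Let $f\in\mathcal{SR}(\mathbb B)$ be such that $\frac{d^\sigma}{dq_{\alpha,k,\mathbf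 i}}f$ belongs to the $\mathbf i$-slice regular Bergman space of $\mathbb B_{\mathbf i}$, i.e. coincides on $\mathbb E_{\mathbf i}$ with one of its elements. Then for all $q\in\mathbb E$ $$f(q)=-\frac{\sigma}{1-\sigma}\big(\alpha q^{\alpha-1}\ast e_{k-1}(q^\alpha)\big)^{-\ast}\ast f'(q)+\frac1{1-\sigma}\int_{\mathbb B_{\mathbf i}}\mathcal B_{\mathbf i}(q,\zeta)\,\frac{d^\sigma}{dq_{\alpha,k,\mathbf i}}f(\zeta)\,d\mu_{\mathbf i}(\zeta),$$ $$f(q)=\exp\Big[\tfrac{1-\sigma}{\sigma}\big(e_k((\tfrac12)^\alpha)-e_k(q^\alpha)\big)\Big]f(\tfrac12)+\int_{\mathbb B_{\mathbf i}}\mathcal K_{\frac12}(q,\zeta)\,\frac{d^\sigma}{dq_{\alpha,k,\mathbf i}}f(\zeta)\,d\mu_{\mathbf i}(\zeta),$$ where $$\mathcal K_{\frac12}(q,\zeta)=\exp\Big[\tfrac{\sigma-1}{\sigma}e_k(q^\alpha)\Big]\ast\int_{\gamma_{\frac12,q}}\frac1\sigma\exp\Big[\tfrac{1-\sigma}{\sigma}e_k(w^\alpha)\Big]\Big(\frac{d}{dw}e_k(w^\alpha)\Big)\,dw\;\mathcal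 B_{\mathbf i}(w,\zeta),$$ the $\ast$-product is taken in $q$, and, for each $q\in\mathbb E$, $\gamma_{\frac12,q}$ is any rectifiable path from $\frac12$ to $q$ contained in $\mathbb B_{I_q}\setminus(-1,0]$ (in $\mathbb B_I\setminus(-1,0]$ for some $I\in\mathbb S^2$ if $q$ is real). All the integrals converge absolutely. -/

import Mathlib

open scoped Quaternion

noncomputable section

namespace SliceFractal

/-! ### Slices of the quaternions -/

/-- The sphere of imaginary units. -/
def imUnits : Set ℍ := {I | I.re = 0 ∧ ‖I‖ = 1}

/-- The complex plane `ℂ(I) = {x + y I}`. -/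
def slicePlane (I : ℍ) : Set ℍ := {q | ∃ x y : ℝ, q = (x : ℍ) + (y : ℍ) * I}

/-- The identification of `ℂ` with `ℂ(I)`, `x + i y ↦ x + y I`. -/
def toSlice (I : ℍ) (z : ℂ) : ℍ := (z.re : ℍ) + (z.im : ℍ) * I

/-- The open unit ball `𝔹` of the quaternions. -/
def unitBall : Set ℍ := Metric.ball 0 1

/-- The slit ball `𝔼 = 𝔹 \ (-1, 0]`. -/
def slitBall : Set ℍ := unitBall \ {q | q.im = 0 ∧ -1 < q.re ∧ q.re ≤ 0}

/-- The slice `𝔼 ∩ ℂ(I)`. -/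
def slitSlice (I : ℍ) : Set ℍ := slitBall ∩ slicePlane I

/-- The imaginary unit `I_q = Im q / |Im q|` of `q`, so that `q = Re q + I_q |Im q|`. For real `q`
its value is `0`; where it occurs below, `I_q` is then multiplied by a vanishing quantity. -/
def sliceUnit (q : ℍ) : ℍ := (‖q.im‖⁻¹ : ℝ) • q.im

/-! ### Slice regular functions and the `*`-product -/

/-- `f` is slice regular on the (open) set `Ω`: real differentiable, with
`(∂/∂x + I ∂/∂y) f = 0` on `Ω ∩ ℂ(I)` for every imaginary unit `I`. -/
def SliceRegularOn (f : ℍ → ℍ) (Ω : Set ℍ) : Prop :=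
  DifferentiableOn ℝ f Ω ∧
    ∀ I ∈ imUnits, ∀ q ∈ Ω ∩ slicePlane I, lineDeriv ℝ f q 1 + I * lineDeriv ℝ f q I = 0

/-- The slice (Cullen) derivative `f' = ∂f/∂x`. -/
def cullenDeriv (f : ℍ → ℍ) (q : ℍ) : ℍ := lineDeriv ℝ f q 1

/-- The component `a` of `f (x + y I) = a (x, y) + I b (x, y)`, at `q = x + y I_q`. -/
def stemRe (f : ℍ → ℍ) (q : ℍ) : ℍ := (2⁻¹ : ℝ) • (f q + f (star q))

/-- The component `b` of `f (x + y I) = a (x, y) + I b (x, y)`, at `q = x + y I_q`. -/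
def stemIm (f : ℍ → ℍ) (q : ℍ) : ℍ := -((2⁻¹ : ℝ) • (sliceUnit q * (f q - f (star q))))

/-- The `*`-product of slice functions on a conjugation-invariant set: if `f = a + I b` and
`g = c + I d`, then `f * g = (a c - b d) + I (a d + b c)`. For power series on the ball centred at
`0` it is `(∑ qⁿ aₙ) * (∑ qⁿ bₙ) = ∑ qⁿ ∑ₖ aₖ bₙ₋ₖ`. -/
def starMul (f g : ℍ → ℍ) (q : ℍ) : ℍ :=
  (stemRe f q * stemRe g q - stemIm f q * stemIm g q) +
    sliceUnit q * (stemRe f q * stemIm g q + stemIm f q * stemRe g q)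

/-- The regular conjugate `f^c`: if `f = a + I b`, then `f^c = ā + I b̄`
(for power series, `∑ qⁿ aₙ ↦ ∑ qⁿ āₙ`). -/
def starConj (f : ℍ → ℍ) (q : ℍ) : ℍ := star (stemRe f q) + sliceUnit q * star (stemIm f q)

/-- The symmetrization `f^s = f * f^c`. -/
def symmetrization (f : ℍ → ℍ) : ℍ → ℍ := starMul f (starConj f)

/-- The `*`-inverse `f^{-*} = (1 / f^s) * f^c`. -/
def starInv (f : ℍ → ℍ) : ℍ → ℍ := starMul (fun q => (symmetrization f q)⁻¹) (starConj f)

/-- The extension operator `P_i`: it extends a function on a slice `ℂ(i)` to a slice function,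
`P_i[h](x + y I) = ½ [(1 + I i) h(x - y i) + (1 - I i) h(x + y i)]`. -/
def sliceExtend (i : ℍ) (h : ℍ → ℍ) (q : ℍ) : ℍ :=
  (2⁻¹ : ℝ) • ((1 + sliceUnit q * i) * h ((q.re : ℍ) - (‖q.im‖ : ℍ) * i) +
    (1 - sliceUnit q * i) * h ((q.re : ℍ) + (‖q.im‖ : ℍ) * i))

/-! ### Powers and truncated exponentials -/

/-- The principal power `q ^ a = exp (a (ln |q| + I_q Arg q))` with real exponent. -/
def qpow (q : ℍ) (a : ℝ) : ℍ :=
  NormedSpace.exp (a • (((Real.log ‖q‖ : ℝ) : ℍ) +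
    ((Complex.arg ⟨q.re, ‖q.im‖⟩ : ℝ) : ℍ) * sliceUnit q))

/-- The truncated exponential `e_k(q) = ∑_{n ≤ k} qⁿ / n!`, with `e_∞(q) = exp q`. -/
def truncExp : ℕ∞ → ℍ → ℍ
  | ⊤, q => NormedSpace.exp q
  | (k : ℕ), q => ∑ n ∈ Finset.range (k + 1), ((n.factorial : ℝ)⁻¹) • q ^ n

/-- The quaternionic fractal measure `q ↦ e_k(q^α)`. -/
def fractalMeasure (α : ℝ) (k : ℕ∞) (q : ℍ) : ℍ := truncExp k (qpow q α)

/-- The fractal-fractional `i`-derivative of `f` at `z ∈ 𝔼 ∩ ℂ(i)`: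
`(1 - σ) f(z) + σ lim_{ζ → z} (e_k(z^α) - e_k(ζ^α))⁻¹ (f(z) - f(ζ))`, with `ζ ∈ 𝔼 ∩ ℂ(i)`. -/
def ffDeriv (σ α : ℝ) (k : ℕ∞) (i : ℍ) (f : ℍ → ℍ) (z : ℍ) : ℍ :=
  (1 - σ) • f z + σ • Filter.limUnder (nhdsWithin z (slitSlice i \ {z}))
    (fun ζ => (fractalMeasure α k z - fractalMeasure α k ζ)⁻¹ * (f z - f ζ))

/-! ### The slice regular Bergman space and its kernel -/

/-- The `i`-slice regular Bergman space of the ball: slice regular functions on `𝔹` whose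
restriction to the disc `𝔹 ∩ ℂ(i)` is square integrable for the area measure. -/
def bergmanSpace (i : ℍ) : Set (ℍ → ℍ) :=
  {g | SliceRegularOn g unitBall ∧
    MeasureTheory.IntegrableOn (fun z : ℂ => ‖g (toSlice i z)‖ ^ 2) (Metric.ball 0 1)}

/-- `h`, defined on the slit slice `𝔼 ∩ ℂ(i)`, belongs to the `i`-slice regular Bergman space: it is
the restriction of one of its elements. -/
def MemBergman (i : ℍ) (h : ℍ → ℍ) : Prop := ∃ g ∈ bergmanSpace i, Set.EqOn h g (slitSlice i)

/-- The Bergman kernel `1 / (π (1 - z ζ̄)²)` of the unit disc of a plane `ℂ(i)`. -/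
def discBergmanKernel (z ζ : ℍ) : ℍ := (Real.pi⁻¹ : ℝ) • ((1 - z * star ζ) ^ 2)⁻¹

/-- The slice regular Bergman kernel associated to `𝔹 ∩ ℂ(i)`: the slice regular extension, in the
first variable, of the Bergman kernel of the disc `𝔹 ∩ ℂ(i)`. -/
def sliceBergmanKernel (i q ζ : ℍ) : ℍ := sliceExtend i (fun z => discBergmanKernel z ζ) q

/-! ### Path integrals on slices and the kernel based at `1/2` -/

/-- `γ` is a rectifiable path, parametrized in a Lipschitz way (for instance by a multiple of arc
length), contained in `(𝔹 ∩ ℂ(I)) \ (-1, 0]` for some imaginary unit `I`. When the end point `q` is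
not real, this forces `I = ± I_q`. -/
def IsSlicePath {p q : ℍ} (γ : Path p q) : Prop :=
  (∃ K, LipschitzWith K γ) ∧ ∃ I ∈ imUnits, ∀ t, γ t ∈ slitSlice I

/-- The 1-form `σ⁻¹ exp[(1-σ)/σ e_k(w^α)] (d/dw e_k(w^α)) dw 𝓑_i(w, ζ)`; the line element `dw`
stands between the (intrinsic) scalar factor and the kernel. -/
def kernelForm (σ α : ℝ) (k : ℕ∞) (i ζ w : ℍ) : ℍ →L[ℝ] ℍ :=
  ContinuousLinearMap.mulLeftRight ℝ ℍ
    (σ⁻¹ • (NormedSpace.exp (((1 - σ) / σ) • fractalMeasure α k w) *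
      cullenDeriv (fractalMeasure α k) w))
    (sliceBergmanKernel i w ζ)

/-- The kernel `𝒦_{1/2}(q, ζ) = exp[(σ-1)/σ e_k(q^α)] * ∫_{γ_q} σ⁻¹ exp[(1-σ)/σ e_k(w^α)]
(d/dw e_k(w^α)) dw 𝓑_i(w, ζ)` (`*`-product in `q`), for a choice of paths `γ_q` from `1/2`
to `q`. -/
def halfKernel (σ α : ℝ) (k : ℕ∞) (i : ℍ) (γ : ∀ q : ℍ, Path (((1 / 2 : ℝ) : ℍ)) q) (q ζ : ℍ) : ℍ :=
  starMul (fun p => NormedSpace.exp (((σ - 1) / σ) • fractalMeasure α k p))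
    (fun p => curveIntegral (kernelForm σ α k i ζ) (γ p)) q

end SliceFractal

end

/-!
Each slice `ℂ(I)` is a copy of `ℂ`, and left multiplication by `I` makes `ℍ` a complex vector space
for which slice regular functions are holomorphic on slices. The complex linear functionals
`coord I p` separate the points of `ℍ`, so the holomorphic facts needed reduce to scalar ones.

Write `φ(q) = e_k(q^α)`. Powers and truncated exponentials are intrinsic, that is, given by one
complex function on all slices; `*`-products with an intrinsic left factor and `*`-inverses of
intrinsic functions are pointwise (`IntrinsicOn.starMul_eq`, `IntrinsicOn.starInv`). On the slice of
`i` the fractal-fractional derivative is `(1 - σ) f + σ φ'⁻¹ f'` (`ffDeriv_toSlice`), and by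
hypothesis it is the restriction of an element `g` of the Bergman space. The representation formula
for `f`, `f'` and `g` propagates `g = (1 - σ) f + σ φ'⁻¹ f'` to every slice
(`eq_add_of_eqOn_slice`).

The integral of the slice regular Bergman kernel against `g` is `g`
(`integral_kernelOnSlice_mul`). On the disc this is the scalar reproducing property
`integral_complexBergman_mul`, proved in polar coordinates with Cauchy's formula for the derivative;
the representation formula extends it to the other slices. Solving for `f` gives the first formula.

For the second, Fubini's theorem moves the path integral outside (`integral_path_kernel`), which
leaves the integral of `σ⁻¹ exp(c φ) φ' g` along the path, `c = (1 - σ) / σ`. This integrand is the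
derivative of `exp(c φ) f`, so that the fundamental theorem of calculus for Lipschitz paths
(`integral_deriv_comp_lipschitz`) evaluates it.
-/

open scoped Quaternion

namespace SliceFractal

open MeasureTheory

/-! ### Algebra of the slices -/

lemma imUnits_mul_self {I : ℍ} (hI : I ∈ imUnits) : I * I = -1 := by
  obtain ⟨h0, h1⟩ := hI
  have hs : star I = -I := Quaternion.star_eq_neg.2 h0
  have h := Quaternion.self_mul_star I
  rw [hs, Quaternion.normSq_eq_norm_mul_self, h1] at h
  have h' : -(I * I) = 1 := by simpa using h
  rw [← h', neg_neg]

lemma imUnits_star {I : ℍ} (hI : I ∈ imUnits) : star I = -I :=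
  Quaternion.star_eq_neg.2 hI.1

lemma neg_mem_imUnits {I : ℍ} (hI : I ∈ imUnits) : -I ∈ imUnits := by
  simpa [imUnits] using hI

/-- The identification `ℂ ≃ ℂ(I)` as a homomorphism of real algebras. -/
noncomputable def sliceHom {I : ℍ} (hI : I ∈ imUnits) : ℂ →ₐ[ℝ] ℍ :=
  Complex.liftAux I (imUnits_mul_self hI)

lemma sliceHom_apply {I : ℍ} (hI : I ∈ imUnits) (z : ℂ) : sliceHom hI z = toSlice I z := by
  rw [sliceHom, Complex.liftAux_apply, toSlice, Quaternion.coe_mul_eq_smul]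
  rfl

lemma toSlice_add (I : ℍ) (z w : ℂ) : toSlice I (z + w) = toSlice I z + toSlice I w := by
  simp only [toSlice, Complex.add_re, Complex.add_im, Quaternion.coe_add]
  noncomm_ring

lemma toSlice_smul (I : ℍ) (r : ℝ) (z : ℂ) : toSlice I (r • z) = r • toSlice I z := by
  simp only [toSlice, Complex.smul_re, Complex.smul_im, smul_eq_mul, Quaternion.coe_mul,
    ← Quaternion.coe_mul_eq_smul, mul_add, mul_assoc]

lemma toSlice_ofReal (I : ℍ) (r : ℝ) : toSlice I (r : ℂ) = (r : ℍ) := by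
  simp [toSlice]

lemma toSlice_mul {I : ℍ} (hI : I ∈ imUnits) (z w : ℂ) :
    toSlice I (z * w) = toSlice I z * toSlice I w := by
  simp only [← sliceHom_apply hI, map_mul]

lemma toSlice_inv {I : ℍ} (hI : I ∈ imUnits) (z : ℂ) : toSlice I z⁻¹ = (toSlice I z)⁻¹ := by
  simp only [← sliceHom_apply hI, map_inv₀]

lemma toSlice_pow {I : ℍ} (hI : I ∈ imUnits) (z : ℂ) (n : ℕ) :
    toSlice I (z ^ n) = toSlice I z ^ n := by
  simp only [← sliceHom_apply hI, map_pow]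

lemma toSlice_sub (I : ℍ) (z w : ℂ) : toSlice I (z - w) = toSlice I z - toSlice I w := by
  rw [eq_sub_iff_add_eq, ← toSlice_add, sub_add_cancel]

lemma toSlice_one (I : ℍ) : toSlice I 1 = 1 := by simp [toSlice]

lemma toSlice_zero (I : ℍ) : toSlice I 0 = 0 := by simp [toSlice]

lemma toSlice_I (I : ℍ) : toSlice I Complex.I = I := by simp [toSlice]

lemma toSlice_neg_conj (I : ℍ) (z : ℂ) : toSlice (-I) (starRingEnd ℂ z) = toSlice I z := by
  simp [toSlice]

lemma star_toSlice {I : ℍ} (hI : I ∈ imUnits) (z : ℂ) :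
    star (toSlice I z) = toSlice I (starRingEnd ℂ z) := by
  simp only [toSlice, Quaternion.coe_mul_eq_smul, star_add,
    Quaternion.star_coe, Quaternion.star_smul, imUnits_star hI, Complex.conj_re, Complex.conj_im,
    smul_neg, neg_smul]

lemma norm_toSlice {I : ℍ} (hI : I ∈ imUnits) (z : ℂ) : ‖toSlice I z‖ = ‖z‖ := by
  have h := Quaternion.self_mul_star (toSlice I z)
  rw [star_toSlice hI, ← toSlice_mul hI, Complex.mul_conj, toSlice_ofReal,
    Quaternion.normSq_eq_norm_mul_self, Quaternion.coe_inj, Complex.normSq_eq_norm_sq, sq] at h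
  nlinarith [norm_nonneg z, norm_nonneg (toSlice I z),
    mul_self_inj (norm_nonneg z) (norm_nonneg (toSlice I z)) |>.1 h]

lemma toSlice_re {I : ℍ} (hI : I ∈ imUnits) (z : ℂ) : (toSlice I z).re = z.re := by
  simp [toSlice, Quaternion.coe_mul_eq_smul, hI.1]

lemma toSlice_im {I : ℍ} (hI : I ∈ imUnits) (z : ℂ) : (toSlice I z).im = z.im • I := by
  have h : I.im = I := by
    conv_rhs => rw [← Quaternion.re_add_im I, hI.1]
    simp
  rw [toSlice, Quaternion.coe_mul_eq_smul, Quaternion.im_add, Quaternion.im_coe, zero_add,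
    Quaternion.im_smul, h]

lemma norm_im_toSlice {I : ℍ} (hI : I ∈ imUnits) (z : ℂ) : ‖(toSlice I z).im‖ = |z.im| := by
  rw [toSlice_im hI, norm_smul, hI.2, mul_one, Real.norm_eq_abs]

lemma sliceUnit_toSlice {I : ℍ} (hI : I ∈ imUnits) (z : ℂ) :
    sliceUnit (toSlice I z) = (|z.im|⁻¹ * z.im) • I := by
  rw [sliceUnit, norm_im_toSlice hI, toSlice_im hI, smul_smul]

lemma toSlice_mem_slicePlane (I : ℍ) (z : ℂ) : toSlice I z ∈ slicePlane I := ⟨z.re, z.im, rfl⟩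

lemma exists_toSlice_of_mem_slicePlane {I q : ℍ} (h : q ∈ slicePlane I) :
    ∃ z, q = toSlice I z := by
  obtain ⟨x, y, rfl⟩ := h
  exact ⟨⟨x, y⟩, rfl⟩

/-- Every quaternion lies in some slice. -/
lemma exists_eq_toSlice (q : ℍ) : ∃ I ∈ imUnits, ∃ z : ℂ, q = toSlice I z := by
  by_cases h : q.im = 0
  · let e : ℍ := ⟨0, 1, 0, 0⟩
    refine ⟨e, ⟨rfl, ?_⟩, q.re, ?_⟩
    · have h1 := Quaternion.normSq_eq_norm_mul_self e
      have h2 : Quaternion.normSq e = 1 := by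
        rw [Quaternion.normSq_def']; simp [e]
      nlinarith [norm_nonneg e]
    · rw [toSlice_ofReal]
      conv_lhs => rw [← Quaternion.re_add_im q, h, add_zero]
  · have hn : ‖q.im‖ ≠ 0 := norm_ne_zero_iff.2 h
    refine ⟨‖q.im‖⁻¹ • q.im, ⟨by simp, ?_⟩, ⟨q.re, ‖q.im‖⟩, ?_⟩
    · rw [norm_smul, norm_inv, norm_norm, inv_mul_cancel₀ hn]
    · rw [toSlice, Quaternion.coe_mul_eq_smul, smul_smul, mul_inv_cancel₀ hn, one_smul,
        Quaternion.re_add_im]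

/-- The unit disc. -/
abbrev disc : Set ℂ := Metric.ball 0 1

/-- The unit disc slit along `(-1, 0]`. -/
def slitDisc : Set ℂ := disc ∩ Complex.slitPlane

lemma isOpen_slitDisc : IsOpen slitDisc := Metric.isOpen_ball.inter Complex.isOpen_slitPlane

lemma toSlice_mem_unitBall {I : ℍ} (hI : I ∈ imUnits) {z : ℂ} :
    toSlice I z ∈ unitBall ↔ z ∈ disc := by
  simp [unitBall, disc, norm_toSlice hI]

lemma toSlice_mem_slitBall {I : ℍ} (hI : I ∈ imUnits) {z : ℂ} :
    toSlice I z ∈ slitBall ↔ z ∈ slitDisc := by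
  have hI0 : I ≠ 0 := by
    intro h
    have := hI.2
    simp [h] at this
  rw [slitBall, Set.mem_sdiff, toSlice_mem_unitBall hI, slitDisc, Set.mem_inter_iff]
  refine and_congr_right fun hz => ?_
  rw [Set.mem_ofPred_eq, toSlice_im hI, toSlice_re hI, smul_eq_zero, or_iff_left hI0,
    Complex.mem_slitPlane_iff]
  have h1 : ‖z‖ < 1 := by simpa using hz
  have h2 := (abs_lt.1 ((Complex.abs_re_le_norm z).trans_lt h1)).1
  grind

lemma conj_mem_disc {z : ℂ} (hz : z ∈ disc) : starRingEnd ℂ z ∈ disc := by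
  simpa [disc] using hz

lemma conj_mem_slitDisc {z : ℂ} (hz : z ∈ slitDisc) : starRingEnd ℂ z ∈ slitDisc := by
  refine ⟨conj_mem_disc hz.1, ?_⟩
  have := Complex.mem_slitPlane_iff.1 hz.2
  exact Complex.mem_slitPlane_iff.2 (by simpa using this)

/-- `toSlice` as a continuous real linear map. -/
noncomputable def toSliceL (I : ℍ) : ℂ →L[ℝ] ℍ :=
  Complex.reCLM.smulRight (1 : ℍ) + Complex.imCLM.smulRight I

@[simp]
lemma toSliceL_apply (I : ℍ) (z : ℂ) : toSliceL I z = toSlice I z := by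
  simp [toSliceL, toSlice, ← Quaternion.coe_mul_eq_smul]

lemma continuous_toSlice (I : ℍ) : Continuous (toSlice I) := by
  simpa [funext (toSliceL_apply I)] using (toSliceL I).continuous

lemma toSlice_exp {I : ℍ} (hI : I ∈ imUnits) (z : ℂ) :
    toSlice I (Complex.exp z) = NormedSpace.exp (toSlice I z) := by
  have hc : Continuous (sliceHom hI) := by
    simpa [funext (sliceHom_apply hI)] using continuous_toSlice I
  rw [← sliceHom_apply hI, ← sliceHom_apply hI, Complex.exp_eq_exp_ℂ]
  exact NormedSpace.map_exp (sliceHom hI) hc z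

/-- The functional `q ↦ Re (q p) - i Re (I q p)`. It is complex linear when `ℂ` acts on `ℍ` by left
multiplication through `ℂ(I)`, and these functionals separate the points of `ℍ`, which reduces
statements on left `ℂ(I)`-valued holomorphic functions to scalar ones. -/
noncomputable def coord (I p : ℍ) : ℍ →L[ℝ] ℂ :=
  LinearMap.toContinuousLinearMap
    { toFun := fun q => ⟨(q * p).re, -(I * q * p).re⟩
      map_add' := fun a b => by
        refine Complex.ext ?_ ?_
        · simp [add_mul]
        · simp [add_mul, mul_add]
          ring
      map_smul' := fun r a => by
        refine Complex.ext ?_ ?_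
        · simp
        · simp
          ring }

lemma coord_apply (I p q : ℍ) : coord I p q = ⟨(q * p).re, -(I * q * p).re⟩ := rfl

lemma coord_unit_mul {I : ℍ} (hI : I ∈ imUnits) (p q : ℍ) :
    coord I p (I * q) = Complex.I * coord I p q := by
  have h : I * (I * q) * p = -(q * p) := by
    rw [← mul_assoc I I q, imUnits_mul_self hI]; simp
  simp only [coord_apply, h]
  apply Complex.ext <;> simp

lemma coord_toSlice_mul {I : ℍ} (hI : I ∈ imUnits) (p : ℍ) (z : ℂ) (q : ℍ) :
    coord I p (toSlice I z * q) = z * coord I p q := by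
  rw [toSlice, add_mul, map_add, mul_assoc, Quaternion.coe_mul_eq_smul,
    Quaternion.coe_mul_eq_smul, map_smul, map_smul, coord_unit_mul hI, Complex.real_smul,
    Complex.real_smul]
  conv_rhs => rw [← Complex.re_add_im z]
  ring

lemma coord_one_toSlice {I : ℍ} (hI : I ∈ imUnits) (z : ℂ) : coord I 1 (toSlice I z) = z := by
  have h := coord_toSlice_mul hI 1 z 1
  have h1 : coord I 1 1 = 1 := by
    rw [coord_apply]; apply Complex.ext <;> simp [hI.1]
  rwa [mul_one, h1, mul_one] at h

/-- The real parts of the functionals `coord I p` separate the points of `ℍ`. -/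
lemma ext_coord_re (I : ℍ) {a b : ℍ} (h : ∀ p, (coord I p a).re = (coord I p b).re) : a = b := by
  have h' : ∀ p, (a * p).re = (b * p).re := h
  have h2 := h' (star (a - b))
  rw [← sub_eq_zero, ← Quaternion.re_sub, ← sub_mul, Quaternion.self_mul_star,
    Quaternion.re_coe, Quaternion.normSq_eq_zero] at h2
  exact sub_eq_zero.1 h2

lemma ext_coord (I : ℍ) {a b : ℍ} (h : ∀ p, coord I p a = coord I p b) : a = b :=
  ext_coord_re I fun p => by rw [h p]

/-! ### The `*`-product with intrinsic functions -/

/-- `f` is intrinsic on the union of the slices of `S`: on every slice it is given by the same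
complex function `Φ`. -/
def IntrinsicOn (f : ℍ → ℍ) (Φ : ℂ → ℂ) (S : Set ℂ) : Prop :=
  ∀ I ∈ imUnits, ∀ z ∈ S, f (toSlice I z) = toSlice I (Φ z)

lemma IntrinsicOn.map_conj {f : ℍ → ℍ} {Φ : ℂ → ℂ} {S : Set ℂ} (h : IntrinsicOn f Φ S)
    (hS : ∀ z ∈ S, starRingEnd ℂ z ∈ S) {I : ℍ} (hI : I ∈ imUnits) {z : ℂ} (hz : z ∈ S) :
    Φ (starRingEnd ℂ z) = starRingEnd ℂ (Φ z) := by
  have h1 := h I hI z hz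
  rw [← toSlice_neg_conj, h _ (neg_mem_imUnits hI) _ (hS z hz), ← toSlice_neg_conj I (Φ z)] at h1
  simpa [coord_one_toSlice (neg_mem_imUnits hI)] using congrArg (coord (-I) 1) h1

/-- The components `a`, `b` of a function `a + I b` are real where it is intrinsic. -/
lemma IntrinsicOn.exists_stem {f : ℍ → ℍ} {Φ : ℂ → ℂ} {S : Set ℂ} (h : IntrinsicOn f Φ S)
    (hS : ∀ z ∈ S, starRingEnd ℂ z ∈ S) {I : ℍ} (hI : I ∈ imUnits) {z : ℂ} (hz : z ∈ S) :
    ∃ a b : ℝ, stemRe f (toSlice I z) = a ∧ stemIm f (toSlice I z) = b := by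
  have hc := h.map_conj hS hI hz
  refine ⟨(Φ z).re, |z.im|⁻¹ * z.im * (Φ z).im, ?_, ?_⟩
  · rw [stemRe, star_toSlice hI, h I hI z hz, h I hI _ (hS z hz), hc, ← toSlice_add,
      Complex.add_conj, toSlice_ofReal, Quaternion.smul_coe]
    simp
  · rw [stemIm, star_toSlice hI, h I hI z hz, h I hI _ (hS z hz), hc, ← toSlice_sub,
      Complex.sub_conj, sliceUnit_toSlice hI, toSlice_mul hI, toSlice_ofReal, toSlice_I,
      Quaternion.coe_mul_eq_smul, smul_mul_smul_comm, imUnits_mul_self hI, smul_smul]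
    simp only [smul_neg, neg_neg]
    rw [← Quaternion.coe_mul_eq_smul, mul_one, Quaternion.coe_inj]
    ring

lemma sliceUnit_mul_self_of_im_ne_zero {q : ℍ} (h : q.im ≠ 0) :
    sliceUnit q * sliceUnit q = -1 := by
  refine imUnits_mul_self ⟨by simp [sliceUnit], ?_⟩
  rw [sliceUnit, norm_smul, norm_inv, norm_norm, inv_mul_cancel₀ (norm_ne_zero_iff.2 h)]

lemma stemRe_add_stemIm (f : ℍ → ℍ) (q : ℍ) : stemRe f q + sliceUnit q * stemIm f q = f q := by
  by_cases h : q.im = 0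
  · have hq : star q = q := by
      rw [← Quaternion.re_add_im q, h]; simp
    have hu : sliceUnit q = 0 := by simp [sliceUnit, h]
    rw [stemRe, hq, hu, zero_mul, add_zero, ← two_smul ℝ, smul_smul]
    norm_num
  · rw [stemIm, stemRe, mul_neg, mul_smul_comm, ← mul_assoc, sliceUnit_mul_self_of_im_ne_zero h,
      neg_one_mul, smul_neg, neg_neg, ← smul_add, add_add_sub_cancel, ← two_smul ℝ, smul_smul]
    norm_num

/-- The `*`-product with an intrinsic left factor is the pointwise product. -/
lemma IntrinsicOn.starMul_eq {f : ℍ → ℍ} {Φ : ℂ → ℂ} {S : Set ℂ} (h : IntrinsicOn f Φ S)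
    (hS : ∀ z ∈ S, starRingEnd ℂ z ∈ S) {I : ℍ} (hI : I ∈ imUnits) {z : ℂ} (hz : z ∈ S)
    (g : ℍ → ℍ) : starMul f g (toSlice I z) = f (toSlice I z) * g (toSlice I z) := by
  obtain ⟨a, b, ha, hb⟩ := h.exists_stem hS hI hz
  rw [← stemRe_add_stemIm f, ← stemRe_add_stemIm g, starMul, ha, hb]
  set u := sliceUnit (toSlice I z)
  set c := stemRe g (toSlice I z)
  set d := stemIm g (toSlice I z)
  have hbd : (b : ℍ) * d = -(u * b * (u * d)) := by
    by_cases hq : (toSlice I z).im = 0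
    · have hu : u = 0 := by simp [u, sliceUnit, hq]
      have hb0 : (b : ℍ) = 0 := by
        rw [← hb, stemIm]
        change -((2⁻¹ : ℝ) • (u * _)) = 0
        rw [hu]; simp
      rw [hb0]; simp
    · rw [← Quaternion.coe_commutes, mul_assoc, ← mul_assoc u u d,
        sliceUnit_mul_self_of_im_ne_zero hq]
      simp
  have hau : (a : ℍ) * (u * d) = u * (a * d) := by
    rw [← mul_assoc, Quaternion.coe_commutes, mul_assoc]
  rw [hbd, add_mul, mul_add, mul_add, mul_add, hau]
  noncomm_ring

lemma IntrinsicOn.starConj_eq {f : ℍ → ℍ} {Φ : ℂ → ℂ} {S : Set ℂ} (h : IntrinsicOn f Φ S)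
    (hS : ∀ z ∈ S, starRingEnd ℂ z ∈ S) {I : ℍ} (hI : I ∈ imUnits) {z : ℂ} (hz : z ∈ S) :
    starConj f (toSlice I z) = f (toSlice I z) := by
  obtain ⟨a, b, ha, hb⟩ := h.exists_stem hS hI hz
  rw [← stemRe_add_stemIm f, starConj, ha, hb, Quaternion.star_coe, Quaternion.star_coe]

lemma IntrinsicOn.starMul {f g : ℍ → ℍ} {Φ Ψ : ℂ → ℂ} {S : Set ℂ} (hf : IntrinsicOn f Φ S)
    (hg : IntrinsicOn g Ψ S) (hS : ∀ z ∈ S, starRingEnd ℂ z ∈ S) :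
    IntrinsicOn (starMul f g) (fun z => Φ z * Ψ z) S := fun I hI z hz => by
  rw [hf.starMul_eq hS hI hz, hf I hI z hz, hg I hI z hz, toSlice_mul hI]

/-- The `*`-inverse of an intrinsic function is its pointwise inverse. -/
lemma IntrinsicOn.starInv {f : ℍ → ℍ} {Φ : ℂ → ℂ} {S : Set ℂ} (h : IntrinsicOn f Φ S)
    (hS : ∀ z ∈ S, starRingEnd ℂ z ∈ S) : IntrinsicOn (starInv f) (fun z => (Φ z)⁻¹) S := by
  have hc : IntrinsicOn (starConj f) Φ S := fun I hI z hz => by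
    rw [h.starConj_eq hS hI hz, h I hI z hz]
  have hs : IntrinsicOn (fun q => (symmetrization f q)⁻¹) (fun z => (Φ z * Φ z)⁻¹) S :=
    fun I hI z hz => by
      rw [toSlice_inv hI, ← h.starMul hc hS I hI z hz]
      rfl
  intro I hI z hz
  rw [SliceFractal.starInv, hs.starMul hc hS I hI z hz]
  congr 1
  by_cases h0 : Φ z = 0
  · simp [h0]
  · field_simp

/-- The extension operator does not depend on which of `I`, `-I` is used to write a point. -/
lemma sliceExtend_toSlice (i : ℍ) (h : ℍ → ℍ) {I : ℍ} (hI : I ∈ imUnits) (z : ℂ) :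
    sliceExtend i h (toSlice I z) = (2⁻¹ : ℝ) • ((1 + I * i) * h (toSlice i (starRingEnd ℂ z)) +
      (1 - I * i) * h (toSlice i z)) := by
  have e : ∀ y : ℝ, ((toSlice I z).re : ℍ) - (y : ℍ) * i = toSlice i ⟨z.re, -y⟩ := fun y => by
    rw [toSlice_re hI, toSlice]; simp [sub_eq_add_neg]
  have e' : ∀ y : ℝ, ((toSlice I z).re : ℍ) + (y : ℍ) * i = toSlice i ⟨z.re, y⟩ := fun y => by
    rw [toSlice_re hI, toSlice]
  rw [sliceExtend, e, e', norm_im_toSlice hI, sliceUnit_toSlice hI]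
  rcases lt_trichotomy z.im 0 with hz | hz | hz
  · have hc : starRingEnd ℂ z = ⟨z.re, |z.im|⟩ := by
      apply Complex.ext <;> simp [abs_of_neg hz]
    have hc' : z = ⟨z.re, -|z.im|⟩ := by
      apply Complex.ext <;> simp [abs_of_neg hz]
    have hs : |z.im|⁻¹ * z.im = -1 := by
      rw [abs_of_neg hz, inv_neg, neg_mul, inv_mul_cancel₀ hz.ne]
    rw [hs, hc, ← hc']
    simp only [neg_smul, one_smul, neg_mul]
    rw [add_comm, sub_neg_eq_add, ← sub_eq_add_neg]
  · -- on the real axis both values of `h` agree, so that the imaginary unit is irrelevant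
    have hc : starRingEnd ℂ z = z := by
      apply Complex.ext <;> simp [hz]
    have hc' : (⟨z.re, 0⟩ : ℂ) = z := by
      apply Complex.ext <;> simp [hz]
    simp only [hz, abs_zero, neg_zero, hc, hc']
    noncomm_ring
  · have hc : starRingEnd ℂ z = ⟨z.re, -|z.im|⟩ := by
      apply Complex.ext <;> simp [abs_of_pos hz]
    have hc' : z = ⟨z.re, |z.im|⟩ := by
      apply Complex.ext <;> simp [abs_of_pos hz]
    have hs : |z.im|⁻¹ * z.im = 1 := by
      rw [abs_of_pos hz]; field_simp
    rw [hs, hc, ← hc', one_smul]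

/-! ### Slice regular functions on a slice and the representation formula -/

/-- The function `F` of a complex variable, with values in `ℍ`, has derivative `F'` at `z` for the
complex structure on `ℍ` given by left multiplication by `I`. -/
def HasSliceDerivAt (I : ℍ) (F : ℂ → ℍ) (F' : ℍ) (z : ℂ) : Prop :=
  HasFDerivAt F (((ContinuousLinearMap.mul ℝ ℍ).flip F').comp (toSliceL I)) z

lemma HasSliceDerivAt.hasDerivAt_coord {I : ℍ} (hI : I ∈ imUnits) {F : ℂ → ℍ} {F' : ℍ} {z : ℂ}
    (h : HasSliceDerivAt I F F' z) (p : ℍ) :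
    HasDerivAt (fun w => coord I p (F w)) (coord I p F') z := by
  rw [hasDerivAt_iff_hasFDerivAt]
  refine hasFDerivAt_of_restrictScalars ℝ ((coord I p).hasFDerivAt.comp z h) ?_
  ext v
  simp [coord_toSlice_mul hI]

lemma HasSliceDerivAt.unique {I : ℍ} {F G : ℂ → ℍ} {F' G' : ℍ} {z : ℂ}
    (hF : HasSliceDerivAt I F F' z) (hG : HasSliceDerivAt I G G' z) (h : F =ᶠ[nhds z] G) :
    F' = G' := by
  have := (hF.congr_of_eventuallyEq h.symm).unique hG
  simpa [toSlice_one] using congrArg (fun L => L 1) this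

/-- The Cauchy–Riemann equation of a slice regular function is complex differentiability on each
slice. -/
lemma SliceRegularOn.hasSliceDerivAt {f : ℍ → ℍ} (hf : SliceRegularOn f unitBall) {I : ℍ}
    (hI : I ∈ imUnits) {z : ℂ} (hz : z ∈ disc) :
    HasSliceDerivAt I (fun w => f (toSlice I w)) (cullenDeriv f (toSlice I z)) z := by
  have hq := (toSlice_mem_unitBall hI).2 hz
  have hd : DifferentiableAt ℝ f (toSlice I z) :=
    hf.1.differentiableAt (Metric.isOpen_ball.mem_nhds hq)
  have h1 := hf.2 I hI _ ⟨hq, toSlice_mem_slicePlane I z⟩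
  rw [hd.lineDeriv_eq_fderiv, hd.lineDeriv_eq_fderiv] at h1
  have hDI : fderiv ℝ f (toSlice I z) I = I * fderiv ℝ f (toSlice I z) 1 := by
    have := congrArg (fun x => I * x) h1
    simp only [mul_add, ← mul_assoc, imUnits_mul_self hI, mul_zero] at this
    rw [neg_one_mul, ← sub_eq_add_neg, sub_eq_zero] at this
    exact this.symm
  have hF : HasFDerivAt f (fderiv ℝ f (toSlice I z)) (toSliceL I z) := by
    simpa using hd.hasFDerivAt
  have hc := hF.comp z (toSliceL I).hasFDerivAt
  have he : f ∘ toSliceL I = fun w => f (toSlice I w) := by ext1 w; simp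
  rw [he] at hc
  rw [HasSliceDerivAt, cullenDeriv, hd.lineDeriv_eq_fderiv]
  refine hc.congr_fderiv ?_
  ext1 v
  have hv : toSlice I v = v.re • (1 : ℍ) + v.im • I := by
    rw [← toSliceL_apply]; simp [toSliceL]
  simp only [ContinuousLinearMap.comp_apply, ContinuousLinearMap.flip_apply,
    ContinuousLinearMap.mul_apply', toSliceL_apply, hv, map_add, map_smul, hDI,
    one_mul]

/-- The right-hand side of the representation formula: the value at `toSlice I z` determined by a
function `G` on the slice of `i`. -/
noncomputable def represent (i I : ℍ) (G : ℂ → ℍ) (z : ℂ) : ℍ :=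
  (2⁻¹ : ℝ) • ((1 + I * i) * G (starRingEnd ℂ z) + (1 - I * i) * G z)

/-- Left multiplication by `1 + I i` intertwines the conjugate action of `ℂ` through `ℂ(i)` with its
action through `ℂ(I)`; with `toSlice_intertwine_sub`, this is why `represent` carries holomorphic
functions on the slice of `i` to holomorphic functions on the slice of `I`. -/
lemma toSlice_intertwine_add {i I : ℍ} (hi : i ∈ imUnits) (hI : I ∈ imUnits) (v : ℂ) :
    (1 + I * i) * toSlice i (starRingEnd ℂ v) = toSlice I v * (1 + I * i) := by
  have h1 : I * i * i = -I := by rw [mul_assoc, imUnits_mul_self hi, mul_neg_one]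
  have h2 : I * (I * i) = -i := by rw [← mul_assoc, imUnits_mul_self hI, neg_one_mul]
  simp only [toSlice, Quaternion.coe_mul_eq_smul, Complex.conj_re, Complex.conj_im, neg_smul,
    mul_add, add_mul, mul_neg, mul_smul_comm, smul_mul_assoc, h1, h2, one_mul, mul_one, smul_neg,
    smul_add, Quaternion.mul_coe_eq_smul]
  abel

lemma toSlice_intertwine_sub {i I : ℍ} (hi : i ∈ imUnits) (hI : I ∈ imUnits) (v : ℂ) :
    (1 - I * i) * toSlice i v = toSlice I v * (1 - I * i) := by
  have h1 : I * i * i = -I := by rw [mul_assoc, imUnits_mul_self hi, mul_neg_one]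
  have h2 : I * (I * i) = -i := by rw [← mul_assoc, imUnits_mul_self hI, neg_one_mul]
  simp only [toSlice, Quaternion.coe_mul_eq_smul,
    mul_add, add_mul, mul_sub, sub_mul, mul_smul_comm, smul_mul_assoc, h1, h2, one_mul, mul_one,
    smul_neg, smul_sub, Quaternion.mul_coe_eq_smul]
  abel

lemma hasSliceDerivAt_represent {i I : ℍ} (hi : i ∈ imUnits) (hI : I ∈ imUnits) {G : ℂ → ℍ}
    {a b : ℍ} {z : ℂ} (hz : HasSliceDerivAt i G a z)
    (hc : HasSliceDerivAt i G b (starRingEnd ℂ z)) :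
    HasSliceDerivAt I (represent i I G)
      ((2⁻¹ : ℝ) • ((1 + I * i) * b + (1 - I * i) * a)) z := by
  have h1 : HasFDerivAt (fun w => G (starRingEnd ℂ w)) _ z :=
    HasFDerivAt.comp (g := G) (f := fun w => starRingEnd ℂ w) z hc
      (Complex.conjCLE : ℂ ≃L[ℝ] ℂ).hasFDerivAt
  have h2 := ((h1.const_mul (1 + I * i)).add (hz.const_mul (1 - I * i))).const_smul (2⁻¹ : ℝ)
  refine h2.congr_fderiv ?_
  ext1 v
  simp only [smul_apply, add_apply,
    ContinuousLinearMap.comp_apply, ContinuousLinearMap.flip_apply,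
    ContinuousLinearMap.mul_apply', toSliceL_apply, smul_eq_mul]
  rw [mul_smul_comm, mul_add, ← mul_assoc, ← mul_assoc, ← mul_assoc, ← mul_assoc, ← toSlice_intertwine_add hi hI, ← toSlice_intertwine_sub hi hI]
  rfl

/-- Identity principle: functions that are complex differentiable on the disc of the slice of `I`
and agree on the real diameter agree. -/
lemma eqOn_disc_of_eq_real {I : ℍ} (hI : I ∈ imUnits) {F G : ℂ → ℍ} {F' G' : ℂ → ℍ}
    (hF : ∀ z ∈ disc, HasSliceDerivAt I F (F' z) z)
    (hG : ∀ z ∈ disc, HasSliceDerivAt I G (G' z) z) (h : ∀ x : ℝ, F x = G x) :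
    Set.EqOn F G disc := by
  intro z hz
  refine ext_coord I fun p => ?_
  have hFa : AnalyticOnNhd ℂ (fun w => coord I p (F w)) disc :=
    DifferentiableOn.analyticOnNhd
      (fun w hw => ((hF w hw).hasDerivAt_coord hI p).differentiableAt.differentiableWithinAt)
      Metric.isOpen_ball
  have hGa : AnalyticOnNhd ℂ (fun w => coord I p (G w)) disc :=
    DifferentiableOn.analyticOnNhd
      (fun w hw => ((hG w hw).hasDerivAt_coord hI p).differentiableAt.differentiableWithinAt)
      Metric.isOpen_ball
  refine hFa.eqOn_of_preconnected_of_frequently_eq hGa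
    (convex_ball (0 : ℂ) 1).isPreconnected (Metric.mem_ball_self one_pos) ?_ hz
  have ht : Filter.Tendsto (fun x : ℝ => (x : ℂ)) (nhdsWithin 0 {0}ᶜ) (nhdsWithin 0 {0}ᶜ) := by
    refine tendsto_nhdsWithin_iff.2 ⟨?_, ?_⟩
    · exact (Complex.continuous_ofReal.tendsto' 0 0 Complex.ofReal_zero).mono_left
        nhdsWithin_le_nhds
    · filter_upwards [self_mem_nhdsWithin] with x hx
      simpa using hx
  exact ht.frequently (Filter.Frequently.of_forall fun x => by rw [h x])

lemma represent_ofReal (i I : ℍ) (G : ℂ → ℍ) (x : ℝ) : represent i I G x = G x := by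
  rw [represent, Complex.conj_ofReal, ← add_mul, add_add_sub_cancel, one_add_one_eq_two, two_mul,
    ← two_smul ℝ, smul_smul]
  norm_num

/-- The representation formula: a slice regular function is determined by its values on the slice
of `i`. -/
lemma SliceRegularOn.eq_represent {f : ℍ → ℍ} (hf : SliceRegularOn f unitBall) {i I : ℍ}
    (hi : i ∈ imUnits) (hI : I ∈ imUnits) {z : ℂ} (hz : z ∈ disc) :
    f (toSlice I z) = represent i I (fun w => f (toSlice i w)) z := by
  refine eqOn_disc_of_eq_real hI (F := fun w => f (toSlice I w))
    (fun w hw => hf.hasSliceDerivAt hI hw)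
    (fun w hw => hasSliceDerivAt_represent hi hI (hf.hasSliceDerivAt hi hw)
      (hf.hasSliceDerivAt hi (conj_mem_disc hw))) (fun x => ?_) hz
  rw [represent_ofReal, toSlice_ofReal, toSlice_ofReal]

/-- The representation formula for the slice derivative, by differentiation of the one for the
function. -/
lemma SliceRegularOn.cullenDeriv_eq_represent {f : ℍ → ℍ} (hf : SliceRegularOn f unitBall)
    {i I : ℍ} (hi : i ∈ imUnits) (hI : I ∈ imUnits) {z : ℂ} (hz : z ∈ disc) :
    cullenDeriv f (toSlice I z) = represent i I (fun w => cullenDeriv f (toSlice i w)) z := by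
  refine (hf.hasSliceDerivAt hI hz).unique
    (hasSliceDerivAt_represent hi hI (hf.hasSliceDerivAt hi hz)
      (hf.hasSliceDerivAt hi (conj_mem_disc hz))) ?_
  filter_upwards [Metric.isOpen_ball.mem_nhds hz] with w hw
  exact hf.eq_represent hi hI hw

/-! ### Powers and truncated exponentials on a slice -/

lemma toSlice_log {I : ℍ} (hI : I ∈ imUnits) {z : ℂ} (hz : z ∈ Complex.slitPlane) :
    ((Real.log ‖toSlice I z‖ : ℝ) : ℍ) +
      ((Complex.arg ⟨(toSlice I z).re, ‖(toSlice I z).im‖⟩ : ℝ) : ℍ) * sliceUnit (toSlice I z) =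
      toSlice I (Complex.log z) := by
  rw [norm_toSlice hI, toSlice_re hI, norm_im_toSlice hI, sliceUnit_toSlice hI, toSlice,
    Complex.log_re, Complex.log_im, Quaternion.coe_mul_eq_smul, Quaternion.coe_mul_eq_smul,
    smul_smul]
  congr 2
  rcases lt_trichotomy z.im 0 with h | h | h
  · have hc : (⟨z.re, |z.im|⟩ : ℂ) = starRingEnd ℂ z := by
      apply Complex.ext <;> simp [abs_of_neg h]
    rw [hc, Complex.arg_conj, if_neg (Complex.slitPlane_arg_ne_pi hz), abs_of_neg h]
    field_simp [h.ne]
  · have h0 : 0 < z.re := (Complex.mem_slitPlane_iff.1 hz).resolve_right (by simpa using h)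
    have hz' : z = (z.re : ℂ) := by apply Complex.ext <;> simp [h]
    rw [h, mul_zero, mul_zero, hz', Complex.arg_ofReal_of_nonneg h0.le]
  · have hc : (⟨z.re, |z.im|⟩ : ℂ) = z := by
      apply Complex.ext <;> simp [abs_of_pos h]
    rw [hc, abs_of_pos h, inv_mul_cancel₀ h.ne', mul_one]

/-- On each slice, the quaternionic power is the principal complex power. -/
lemma qpow_toSlice {I : ℍ} (hI : I ∈ imUnits) {z : ℂ} (hz : z ∈ Complex.slitPlane) (a : ℝ) :
    qpow (toSlice I z) a = toSlice I (z ^ (a : ℂ)) := by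
  rw [qpow, toSlice_log hI hz, ← toSlice_smul, ← toSlice_exp hI,
    Complex.cpow_def_of_ne_zero (Complex.slitPlane_ne_zero hz), Complex.real_smul, mul_comm]

/-- The complex truncated exponential. -/
noncomputable def complexTruncExp : ℕ∞ → ℂ → ℂ
  | ⊤, z => Complex.exp z
  | (k : ℕ), z => ∑ n ∈ Finset.range (k + 1), ((n.factorial : ℝ)⁻¹) • z ^ n

lemma truncExp_toSlice {I : ℍ} (hI : I ∈ imUnits) (k : ℕ∞) (z : ℂ) :
    truncExp k (toSlice I z) = toSlice I (complexTruncExp k z) := by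
  cases k with
  | top => exact (toSlice_exp hI z).symm
  | coe k =>
    change ∑ n ∈ Finset.range (k + 1), ((n.factorial : ℝ)⁻¹) • (toSlice I z) ^ n =
      toSlice I (∑ n ∈ Finset.range (k + 1), ((n.factorial : ℝ)⁻¹) • z ^ n)
    simp only [← sliceHom_apply hI, map_sum, map_smul, map_pow]

lemma hasDerivAt_complexTruncExp {k : ℕ∞} (hk : 1 ≤ k) (z : ℂ) :
    HasDerivAt (complexTruncExp k) (complexTruncExp (k - 1) z) z := by
  cases k with
  | top => exact Complex.hasDerivAt_exp z
  | coe k =>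
    obtain ⟨m, rfl⟩ : ∃ m, k = m + 1 := ⟨k - 1, by
      have : 1 ≤ k := by exact_mod_cast hk
      omega⟩
    have h1 : (((m + 1 : ℕ) : ℕ∞) - 1) = (m : ℕ∞) := by
      exact (ENat.natCast_sub (m + 1) 1).symm
    rw [h1]
    change HasDerivAt
      (fun z : ℂ => ∑ n ∈ Finset.range (m + 1 + 1), ((n.factorial : ℝ)⁻¹) • z ^ n)
      (∑ n ∈ Finset.range (m + 1), ((n.factorial : ℝ)⁻¹) • z ^ n) z
    have h2 : HasDerivAt
        (fun z : ℂ => ∑ n ∈ Finset.range (m + 1 + 1), ((n.factorial : ℝ)⁻¹) • z ^ n)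
        (∑ n ∈ Finset.range (m + 1 + 1), ((n.factorial : ℝ)⁻¹) • ((n : ℂ) * z ^ (n - 1))) z :=
      HasDerivAt.fun_sum fun n _ => (hasDerivAt_pow n z).fun_const_smul ((n.factorial : ℝ)⁻¹)
    convert h2 using 1
    rw [Finset.sum_range_succ' _ (m + 1)]
    simp only [Nat.cast_zero, zero_mul, smul_zero, add_zero, Nat.add_sub_cancel]
    refine Finset.sum_congr rfl fun n _ => ?_
    have : ((n : ℂ) + 1) ≠ 0 := by exact_mod_cast n.succ_ne_zero
    rw [Nat.factorial_succ, Complex.real_smul, Complex.real_smul]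
    push_cast
    field_simp

/-- The fractal measure `z ↦ e_k(z^α)` on `ℂ`. -/
noncomputable def complexMeasure (α : ℝ) (k : ℕ∞) (z : ℂ) : ℂ :=
  complexTruncExp k (z ^ (α : ℂ))

/-- The derivative `α z^{α-1} e_{k-1}(z^α)` of `z ↦ e_k(z^α)`. -/
noncomputable def complexMeasureDeriv (α : ℝ) (k : ℕ∞) (z : ℂ) : ℂ :=
  (α * z ^ ((α - 1 : ℝ) : ℂ)) * complexMeasure α (k - 1) z

lemma hasDerivAt_complexMeasure (α : ℝ) {k : ℕ∞} (hk : 1 ≤ k) {z : ℂ}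
    (hz : z ∈ Complex.slitPlane) :
    HasDerivAt (complexMeasure α k) (complexMeasureDeriv α k z) z := by
  have h := (hasDerivAt_complexTruncExp hk (z ^ (α : ℂ))).comp z
    ((hasDerivAt_id z).cpow_const (c := (α : ℂ)) hz)
  refine h.congr_deriv ?_
  simp only [complexMeasureDeriv, complexMeasure, id, mul_one]
  push_cast
  ring

lemma intrinsicOn_fractalMeasure (α : ℝ) (k : ℕ∞) :
    IntrinsicOn (fractalMeasure α k) (complexMeasure α k) slitDisc := fun I hI z hz => by
  rw [fractalMeasure, qpow_toSlice hI hz.2, truncExp_toSlice hI, complexMeasure]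

lemma intrinsicOn_exp_smul_fractalMeasure (c α : ℝ) (k : ℕ∞) :
    IntrinsicOn (fun p => NormedSpace.exp (c • fractalMeasure α k p))
      (fun z => Complex.exp (c * complexMeasure α k z)) slitDisc := fun I hI z hz => by
  beta_reduce
  rw [intrinsicOn_fractalMeasure α k I hI z hz, ← toSlice_smul, ← toSlice_exp hI,
    Complex.real_smul]

lemma intrinsicOn_starMul_deriv (α : ℝ) (k : ℕ∞) :
    IntrinsicOn (starMul (fun p => α • qpow p (α - 1)) (fractalMeasure α (k - 1)))
      (complexMeasureDeriv α k) slitDisc := by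
  have h : IntrinsicOn (fun p => α • qpow p (α - 1)) (fun z => α * z ^ ((α - 1 : ℝ) : ℂ))
      slitDisc := fun I hI z hz => by
    beta_reduce
    rw [qpow_toSlice hI hz.2, ← toSlice_smul, Complex.real_smul]
  exact h.starMul (intrinsicOn_fractalMeasure α (k - 1)) fun z => conj_mem_slitDisc

lemma cullenDeriv_fractalMeasure (α : ℝ) {k : ℕ∞} (hk : 1 ≤ k) :
    IntrinsicOn (cullenDeriv (fractalMeasure α k)) (complexMeasureDeriv α k) slitDisc := by
  intro I hI z hz
  have h1 : HasDerivAt (fun t : ℝ => complexMeasure α k (z + t)) (complexMeasureDeriv α k z) 0 := by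
    have h0 : HasDerivAt (complexMeasure α k) (complexMeasureDeriv α k z) (z + ((0 : ℝ) : ℂ)) := by
      simpa using hasDerivAt_complexMeasure α hk hz.2
    have h2 : HasDerivAt (fun t : ℝ => z + (t : ℂ)) 1 0 :=
      (Complex.ofRealCLM.hasDerivAt (x := (0 : ℝ))).const_add z
    have h3 := HasDerivAt.scomp (0 : ℝ) h0 h2
    rwa [one_smul] at h3
  have h2 : HasDerivAt (fun t : ℝ => toSlice I (complexMeasure α k (z + t)))
      (toSlice I (complexMeasureDeriv α k z)) 0 := by
    have := (toSliceL I).hasFDerivAt.comp_hasDerivAt (0 : ℝ) h1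
    simpa [Function.comp_def] using this
  have hev : (fun t : ℝ => fractalMeasure α k (toSlice I z + t • (1 : ℍ))) =ᶠ[nhds 0]
      fun t : ℝ => toSlice I (complexMeasure α k (z + t)) := by
    have hc : ContinuousAt (fun t : ℝ => z + (t : ℂ)) 0 := by fun_prop
    filter_upwards [hc.preimage_mem_nhds (isOpen_slitDisc.mem_nhds (by simpa using hz))] with t ht
    rw [← intrinsicOn_fractalMeasure α k I hI _ ht, toSlice_add, toSlice_ofReal]
    congr 2
    rw [← Quaternion.coe_mul_eq_smul, mul_one]
  exact (h2.congr_of_eventuallyEq hev).deriv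

/-- The derivative of the fractal measure does not vanish on the slit disc. -/
lemma complexMeasureDeriv_ne_zero {α : ℝ} (hα : 0 < α) {k : ℕ∞}
    (hne : ∀ q ∈ slitBall, fractalMeasure α (k - 1) q ≠ 0) {I : ℍ} (hI : I ∈ imUnits) {z : ℂ}
    (hz : z ∈ slitDisc) : complexMeasureDeriv α k z ≠ 0 := by
  have h := hne _ ((toSlice_mem_slitBall hI).2 hz)
  rw [intrinsicOn_fractalMeasure α (k - 1) I hI z hz] at h
  refine mul_ne_zero (mul_ne_zero (by exact_mod_cast hα.ne') ?_) fun h0 => ?_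
  · rw [Complex.cpow_def_of_ne_zero (Complex.slitPlane_ne_zero hz.2)]
    exact Complex.exp_ne_zero _
  · rw [h0, toSlice_zero] at h
    exact h rfl

/-! ### The fractal-fractional derivative on a slice -/

lemma HasSliceDerivAt.tendsto_slope {I : ℍ} (hI : I ∈ imUnits) {F : ℂ → ℍ} {F' : ℍ} {z : ℂ}
    (h : HasSliceDerivAt I F F' z) :
    Filter.Tendsto (fun w => toSlice I (w - z)⁻¹ * (F w - F z)) (nhdsWithin z {z}ᶜ)
      (nhds F') := by
  rw [tendsto_iff_norm_sub_tendsto_zero]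
  refine ((hasFDerivAt_iff_tendsto.1 h).mono_left nhdsWithin_le_nhds).congr' ?_
  filter_upwards [self_mem_nhdsWithin] with w hw
  have hwz : w - z ≠ 0 := sub_ne_zero.2 hw
  have e : toSlice I (w - z)⁻¹ * (F w - F z) - F' =
      toSlice I (w - z)⁻¹ * (F w - F z - toSlice I (w - z) * F') := by
    rw [mul_sub _ (F w - F z), ← mul_assoc, ← toSlice_mul hI, inv_mul_cancel₀ hwz, toSlice_one, one_mul]
  rw [e, norm_mul, norm_toSlice hI, norm_inv]
  simp

lemma isometry_toSlice {I : ℍ} (hI : I ∈ imUnits) : Isometry (toSlice I) :=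
  Isometry.of_dist_eq fun z w => by
    rw [dist_eq_norm, dist_eq_norm, ← toSlice_sub, norm_toSlice hI]

lemma slitSlice_sdiff {I : ℍ} (hI : I ∈ imUnits) (z : ℂ) :
    slitSlice I \ {toSlice I z} = toSlice I '' (slitDisc \ {z}) := by
  ext q
  constructor
  · rintro ⟨⟨h1, h2⟩, h3⟩
    obtain ⟨w, rfl⟩ := exists_toSlice_of_mem_slicePlane h2
    exact ⟨w, ⟨(toSlice_mem_slitBall hI).1 h1, fun h => h3 (by simp at h; simp [h])⟩, rfl⟩
  · rintro ⟨w, ⟨h1, h2⟩, rfl⟩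
    exact ⟨⟨(toSlice_mem_slitBall hI).2 h1, toSlice_mem_slicePlane I w⟩,
      fun h => h2 ((isometry_toSlice hI).injective h)⟩

/-- On the slice of `i`, the fractal-fractional derivative is `(1 - σ) f + σ φ'⁻¹ f'`, where
`φ(z) = e_k(z^α)`. -/
lemma ffDeriv_toSlice (σ : ℝ) {α : ℝ} {k : ℕ∞} (hk : 1 ≤ k) {i : ℍ} (hi : i ∈ imUnits)
    {f : ℍ → ℍ} (hf : SliceRegularOn f unitBall) {z : ℂ} (hz : z ∈ slitDisc)
    (hne : complexMeasureDeriv α k z ≠ 0) :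
    ffDeriv σ α k i f (toSlice i z) = (1 - σ) • f (toSlice i z) +
      σ • (toSlice i (complexMeasureDeriv α k z)⁻¹ * cullenDeriv f (toSlice i z)) := by
  have hnhds : nhdsWithin z (slitDisc \ {z}) = nhdsWithin z {z}ᶜ := by
    rw [Set.sdiff_eq, Set.inter_comm]
    exact nhdsWithin_inter_of_mem' (mem_nhdsWithin_of_mem_nhds (isOpen_slitDisc.mem_nhds hz))
  rw [ffDeriv, slitSlice_sdiff hi, ← (isometry_toSlice hi).isEmbedding.map_nhdsWithin_eq, hnhds]
  congr 2
  refine Filter.Tendsto.limUnder_eq (Filter.tendsto_map'_iff.2 ?_)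
  have h1 := hasDerivAt_iff_tendsto_slope.1 (hasDerivAt_complexMeasure α hk hz.2)
  have h2 := ((continuous_toSlice i).tendsto _).comp (h1.inv₀ hne)
  refine (h2.mul ((hf.hasSliceDerivAt hi hz.1).tendsto_slope hi)).congr' ?_
  filter_upwards [self_mem_nhdsWithin,
    mem_nhdsWithin_of_mem_nhds (isOpen_slitDisc.mem_nhds hz)] with w hw hws
  have hwz : w - z ≠ 0 := sub_ne_zero.2 hw
  have hφ := intrinsicOn_fractalMeasure α k i hi
  simp only [Function.comp_def]
  rw [hφ z hz, hφ w hws, ← toSlice_sub, ← toSlice_inv hi, ← mul_assoc, ← toSlice_mul hi,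
    slope_def_field, inv_div, ← neg_sub (f (toSlice i z)), mul_neg, ← neg_mul]
  congr 1
  have e : (complexMeasure α k z - complexMeasure α k w)⁻¹ =
      (-1 : ℝ) • ((w - z) / (complexMeasure α k w - complexMeasure α k z) * (w - z)⁻¹) := by
    rw [div_mul_eq_mul_div, mul_inv_cancel₀ hwz, ← neg_sub, inv_neg, one_div]
    simp
  rw [e, toSlice_smul]
  simp

/-! ### The Bergman projection on the disc -/

lemma complex_polarCoord_symm_eq (p : ℝ × ℝ) :
    Complex.polarCoord.symm p = circleMap 0 p.1 p.2 := by
  rw [Complex.polarCoord_symm_apply, circleMap, Complex.exp_mul_I]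
  push_cast
  ring

lemma circleMap_mem_disc {r θ : ℝ} (hr : r ∈ Set.Ioo (0 : ℝ) 1) : circleMap 0 r θ ∈ disc := by
  simpa [disc, abs_of_pos hr.1] using hr.2

/-- Polar coordinates on the unit disc. -/
lemma setIntegral_disc_eq_polar {h : ℂ → ℂ} (hc : ContinuousOn h disc)
    (hi : IntegrableOn h disc) :
    ∫ ζ in disc, h ζ = ∫ r in (0 : ℝ)..1, ∫ θ in -Real.pi..Real.pi, r • h (circleMap 0 r θ) := by
  set S : Set (ℝ × ℝ) := Set.Ioo (0 : ℝ) 1 ×ˢ Set.Ioo (-Real.pi) Real.pi with hS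
  have hSm : MeasurableSet S := measurableSet_Ioo.prod measurableSet_Ioo
  have hST : S ⊆ polarCoord.target := by
    rw [polarCoord_target]
    exact Set.prod_mono (fun x hx => hx.1) le_rfl
  -- inside the target of polar coordinates, `S` is the preimage of the disc
  have hind : ∀ {E : Type} [Zero E] (u : ℂ → E), ∀ p ∈ polarCoord.target,
      disc.indicator u (Complex.polarCoord.symm p) =
        S.indicator (fun p => u (circleMap 0 p.1 p.2)) p := by
    intro E _ u p hp
    rw [polarCoord_target] at hp
    have hp1 : 0 < p.1 := hp.1
    by_cases h1 : p.1 < 1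
    · rw [complex_polarCoord_symm_eq, Set.indicator_of_mem (circleMap_mem_disc ⟨hp1, h1⟩),
        Set.indicator_of_mem (show p ∈ S from ⟨⟨hp1, h1⟩, hp.2⟩)]
    · rw [complex_polarCoord_symm_eq, Set.indicator_of_notMem, Set.indicator_of_notMem]
      · exact fun hpS => h1 hpS.1.2
      · simpa [disc, abs_of_pos hp1] using h1
  have hint : IntegrableOn (fun p : ℝ × ℝ => p.1 • h (circleMap 0 p.1 p.2)) S := by
    refine ⟨ContinuousOn.aestronglyMeasurable ?_ hSm, ?_⟩
    · refine continuous_fst.continuousOn.smul (hc.comp ?_ fun p hp => circleMap_mem_disc hp.1)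
      unfold circleMap
      fun_prop
    · have h1 := Complex.lintegral_comp_polarCoord_symm (disc.indicator fun ζ => ‖h ζ‖ₑ)
      rw [lintegral_indicator Metric.isOpen_ball.measurableSet] at h1
      have h2 := hi.2
      rw [HasFiniteIntegral, ← h1] at h2
      refine lt_of_le_of_lt ?_ h2
      refine le_trans (le_of_eq (setLIntegral_congr_fun hSm fun p hp => ?_))
        (lintegral_mono_set hST)
      have hp1 : 0 < p.1 := hp.1.1
      simp only [hind _ p (hST hp), Set.indicator_of_mem hp, enorm_smul, smul_eq_mul,
        Real.enorm_eq_ofReal hp1.le]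
  calc ∫ ζ in disc, h ζ = ∫ ζ, disc.indicator h ζ :=
        (integral_indicator Metric.isOpen_ball.measurableSet).symm
    _ = ∫ p in polarCoord.target, p.1 • disc.indicator h (Complex.polarCoord.symm p) :=
        (Complex.integral_comp_polarCoord_symm _).symm
    _ = ∫ p in polarCoord.target,
          S.indicator (fun p => p.1 • h (circleMap 0 p.1 p.2)) p := by
        refine setIntegral_congr_fun polarCoord.open_target.measurableSet fun p hp => ?_
        simp only [hind _ p hp, Set.indicator_smul]
    _ = ∫ p in S, p.1 • h (circleMap 0 p.1 p.2) := by
        rw [setIntegral_indicator hSm, Set.inter_eq_self_of_subset_right hST]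
    _ = ∫ r in Set.Ioo (0 : ℝ) 1, ∫ θ in Set.Ioo (-Real.pi) Real.pi,
          r • h (circleMap 0 r θ) := setIntegral_prod _ hint
    _ = _ := by
        have hpi : -Real.pi ≤ Real.pi := by linarith [Real.pi_pos]
        rw [intervalIntegral.integral_of_le zero_le_one, integral_Ioc_eq_integral_Ioo]
        simp only [intervalIntegral.integral_of_le hpi, integral_Ioc_eq_integral_Ioo]

/-- On the circle of radius `r` one has `ζ̄ = r² / ζ`, which turns the Bergman integrand into the
integrand of Cauchy's formula for the derivative of `ζ g(ζ)` at `r² z`. -/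
lemma integral_circle_bergman {g : ℂ → ℂ} (hg : DifferentiableOn ℂ g disc) {z : ℂ}
    (hz : z ∈ disc) {r : ℝ} (hr : r ∈ Set.Ioo (0 : ℝ) 1) :
    ∫ θ in -Real.pi..Real.pi, ((1 - z * starRingEnd ℂ (circleMap 0 r θ)) ^ 2)⁻¹ *
        g (circleMap 0 r θ) =
      2 * Real.pi * deriv (fun ζ => ζ * g ζ) (z * (r : ℂ) ^ 2) := by
  have hz1 : ‖z‖ < 1 := by simpa using hz
  have hw : z * (r : ℂ) ^ 2 ∈ Metric.ball (0 : ℂ) r := by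
    have hr0 := hr.1
    simp only [Metric.mem_ball, dist_zero_right, norm_mul, norm_pow, Complex.norm_real,
      Real.norm_eq_abs, abs_of_pos hr0]
    nlinarith [hr.2, norm_nonneg z, mul_pos hr0 hr0]
  have hF : DifferentiableOn ℂ (fun ζ => ζ * g ζ) disc := differentiableOn_id.mul hg
  have hC := Complex.two_pi_I_inv_smul_circleIntegral_sub_sq_inv_smul_of_differentiable
    Metric.isOpen_ball (Metric.closedBall_subset_ball hr.2) hF hw
  have hper : Function.Periodic (fun θ => ((1 - z * starRingEnd ℂ (circleMap 0 r θ)) ^ 2)⁻¹ *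
      g (circleMap 0 r θ)) (2 * Real.pi) := fun θ => by
    simp only [periodic_circleMap 0 r θ]
  have hshift := hper.intervalIntegral_add_eq (-Real.pi) 0
  rw [show -Real.pi + 2 * Real.pi = Real.pi by ring, zero_add] at hshift
  rw [hshift, ← hC, circleIntegral]
  have hpt : ∀ θ : ℝ, deriv (circleMap 0 r) θ • ((circleMap 0 r θ - z * (r : ℂ) ^ 2) ^ 2)⁻¹ •
      (circleMap 0 r θ * g (circleMap 0 r θ)) = Complex.I *
        (((1 - z * starRingEnd ℂ (circleMap 0 r θ)) ^ 2)⁻¹ * g (circleMap 0 r θ)) := by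
    intro θ
    have hn : circleMap 0 r θ ≠ 0 := circleMap_ne_center hr.1.ne'
    have hrr : (r : ℂ) ^ 2 = circleMap 0 r θ * starRingEnd ℂ (circleMap 0 r θ) := by
      rw [Complex.mul_conj, Complex.normSq_eq_norm_sq, norm_circleMap_zero, sq_abs]
      push_cast
      rfl
    have hfac : circleMap 0 r θ - z * (r : ℂ) ^ 2 =
        circleMap 0 r θ * (1 - z * starRingEnd ℂ (circleMap 0 r θ)) := by
      rw [hrr]; ring
    rw [deriv_circleMap, hfac, mul_pow, mul_inv, smul_eq_mul, smul_eq_mul]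
    field_simp
  simp only [hpt, intervalIntegral.integral_const_mul]
  rw [smul_eq_mul]
  have hpi : (Real.pi : ℂ) ≠ 0 := by exact_mod_cast Real.pi_ne_zero
  field_simp [Complex.I_ne_zero]

/-- The Bergman kernel of the unit disc. -/
noncomputable def complexBergman (z ζ : ℂ) : ℂ :=
  (Real.pi⁻¹ : ℝ) • ((1 - z * starRingEnd ℂ ζ) ^ 2)⁻¹

lemma one_sub_norm_le {z ζ : ℂ} (hζ : ζ ∈ disc) :
    1 - ‖z‖ ≤ ‖1 - z * starRingEnd ℂ ζ‖ := by
  have hζ1 : ‖ζ‖ < 1 := by simpa using hζ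
  have h := norm_sub_norm_le (1 : ℂ) (z * starRingEnd ℂ ζ)
  rw [norm_one, norm_mul, RCLike.norm_conj] at h
  nlinarith [norm_nonneg z]

lemma norm_complexBergman_le {z ζ : ℂ} {ρ : ℝ} (hρ : ρ < 1) (hz : ‖z‖ ≤ ρ) (hζ : ζ ∈ disc) :
    ‖complexBergman z ζ‖ ≤ Real.pi⁻¹ * ((1 - ρ) ^ 2)⁻¹ := by
  have h1 : 0 < 1 - ρ := by linarith
  have h2 : 1 - ρ ≤ ‖1 - z * starRingEnd ℂ ζ‖ := by linarith [one_sub_norm_le (z := z) hζ]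
  rw [complexBergman, norm_smul, Real.norm_of_nonneg (by positivity), norm_inv, norm_pow]
  gcongr

lemma measurable_complexBergman : Measurable fun p : ℂ × ℂ => complexBergman p.1 p.2 := by
  have h : Continuous fun p : ℂ × ℂ => (1 - p.1 * starRingEnd ℂ p.2) ^ 2 :=
    (continuous_const.sub
      (continuous_fst.mul (Complex.continuous_conj.comp continuous_snd))).pow 2
  exact h.measurable.inv.const_smul (Real.pi⁻¹ : ℝ)

lemma integrableOn_complexBergman_mul {g : ℂ → ℂ} (hi : IntegrableOn g disc) {z : ℂ}
    (hz : z ∈ disc) : IntegrableOn (fun ζ => complexBergman z ζ * g ζ) disc := by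
  have hz1 : ‖z‖ < 1 := by simpa using hz
  refine Integrable.bdd_mul (c := Real.pi⁻¹ * ((1 - ‖z‖) ^ 2)⁻¹) hi ?_ ?_
  · exact (measurable_complexBergman.comp measurable_prodMk_left).aestronglyMeasurable
  · filter_upwards [ae_restrict_mem Metric.isOpen_ball.measurableSet] with ζ hζ
    exact norm_complexBergman_le hz1 le_rfl hζ

/-- The reproducing property of the Bergman kernel of the disc: in polar coordinates the integral
is `∫₀¹ 2r (ζ g)'(r² z) dr`, whose integrand is the derivative of `r² g(r² z)`. -/
lemma integral_complexBergman_mul {g : ℂ → ℂ} (hg : DifferentiableOn ℂ g disc)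
    (hi : IntegrableOn g disc) {z : ℂ} (hz : z ∈ disc) :
    ∫ ζ in disc, complexBergman z ζ * g ζ = g z := by
  have hz1 : ‖z‖ < 1 := by simpa using hz
  have hcont : ContinuousOn (fun ζ => complexBergman z ζ * g ζ) disc := by
    refine ContinuousOn.mul ?_ hg.continuousOn
    have h : Continuous fun ζ : ℂ => (1 - z * starRingEnd ℂ ζ) ^ 2 :=
      (continuous_const.sub (continuous_const.mul Complex.continuous_conj)).pow 2
    refine (h.continuousOn.inv₀ fun ζ hζ => ?_).const_smul (Real.pi⁻¹ : ℝ)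
    have : 0 < ‖1 - z * starRingEnd ℂ ζ‖ := by linarith [one_sub_norm_le (z := z) hζ]
    exact pow_ne_zero 2 (norm_pos_iff.1 this)
  rw [setIntegral_disc_eq_polar hcont (integrableOn_complexBergman_mul hi hz)]
  have hmem : ∀ r ∈ Set.Icc (0 : ℝ) 1, z * (r : ℂ) ^ 2 ∈ disc := by
    intro r hr
    have h2 : r ^ 2 ≤ 1 := pow_le_one₀ hr.1 hr.2
    simp only [disc, Metric.mem_ball, dist_zero_right, norm_mul, norm_pow, Complex.norm_real,
      Real.norm_eq_abs, sq_abs]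
    nlinarith [norm_nonneg z]
  have hF : DifferentiableOn ℂ (fun ζ => ζ * g ζ) disc := differentiableOn_id.mul hg
  set D : ℂ → ℂ := deriv fun ζ => ζ * g ζ with hD
  have hDc : ContinuousOn D disc := (hF.deriv Metric.isOpen_ball).continuousOn
  have hdiff : ∀ w ∈ disc, DifferentiableAt ℂ g w := fun w hw =>
    hg.differentiableAt (Metric.isOpen_ball.mem_nhds hw)
  have hDw : ∀ w ∈ disc, D w = g w + w * deriv g w := fun w hw => by
    have := (hasDerivAt_id w).mul (hdiff w hw).hasDerivAt
    have h2 := this.deriv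
    simp only [id, one_mul] at h2
    exact h2
  have hinner : ∀ r ∈ Set.Ioo (0 : ℝ) 1,
      ∫ θ in -Real.pi..Real.pi, r • (complexBergman z (circleMap 0 r θ) * g (circleMap 0 r θ)) =
        2 * (r : ℂ) * D (z * (r : ℂ) ^ 2) := by
    intro r hr
    have h := integral_circle_bergman hg hz hr
    simp only [complexBergman, Complex.real_smul, mul_assoc, intervalIntegral.integral_const_mul]
    rw [h]
    have hpi : (Real.pi : ℂ) ≠ 0 := by exact_mod_cast Real.pi_ne_zero
    push_cast
    rw [hD]
    field_simp
  have hderiv : ∀ r ∈ Set.uIcc (0 : ℝ) 1,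
      HasDerivAt (fun r : ℝ => (r : ℂ) ^ 2 * g (z * (r : ℂ) ^ 2))
        (2 * (r : ℂ) * D (z * (r : ℂ) ^ 2)) r := by
    intro r hr
    rw [Set.uIcc_of_le zero_le_one] at hr
    have h1 : HasDerivAt (fun w : ℂ => w ^ 2) (2 * (r : ℂ)) (r : ℂ) := by
      simpa using hasDerivAt_pow 2 (r : ℂ)
    have h2 := (hdiff _ (hmem r hr)).hasDerivAt.comp (r : ℂ) (h1.const_mul z)
    have h3 := (h1.mul h2).comp_ofReal
    refine h3.congr_deriv ?_
    rw [hDw _ (hmem r hr)]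
    simp only [Function.comp_apply]
    ring
  have hcontr : ContinuousOn (fun r : ℝ => 2 * (r : ℂ) * D (z * (r : ℂ) ^ 2))
      (Set.uIcc 0 1) := by
    rw [Set.uIcc_of_le zero_le_one]
    refine ContinuousOn.mul (by fun_prop) (hDc.comp (by fun_prop) hmem)
  have hcongr : ∫ r in (0 : ℝ)..1, ∫ θ in -Real.pi..Real.pi,
      r • (complexBergman z (circleMap 0 r θ) * g (circleMap 0 r θ)) =
        ∫ r in (0 : ℝ)..1, 2 * (r : ℂ) * D (z * (r : ℂ) ^ 2) := by
    rw [intervalIntegral.integral_of_le zero_le_one, intervalIntegral.integral_of_le zero_le_one,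
      integral_Ioc_eq_integral_Ioo, integral_Ioc_eq_integral_Ioo]
    exact setIntegral_congr_fun measurableSet_Ioo hinner
  rw [hcongr, intervalIntegral.integral_eq_sub_of_hasDerivAt hderiv hcontr.intervalIntegrable]
  simp

/-! ### The slice regular Bergman kernel -/

/-- The slice regular Bergman kernel at `toSlice I z`, `toSlice i ζ`. -/
noncomputable def kernelOnSlice (i I : ℍ) (z ζ : ℂ) : ℍ :=
  represent i I (fun w => toSlice i (complexBergman w ζ)) z

lemma sliceBergmanKernel_toSlice {i I : ℍ} (hi : i ∈ imUnits) (hI : I ∈ imUnits) (z ζ : ℂ) :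
    sliceBergmanKernel i (toSlice I z) (toSlice i ζ) = kernelOnSlice i I z ζ := by
  have h : ∀ w, discBergmanKernel (toSlice i w) (toSlice i ζ) =
      toSlice i (complexBergman w ζ) := fun w => by
    rw [discBergmanKernel, complexBergman, toSlice_smul, toSlice_inv hi, toSlice_pow hi,
      toSlice_sub, toSlice_one, toSlice_mul hi, star_toSlice hi]
  rw [sliceBergmanKernel, sliceExtend_toSlice i _ hI, kernelOnSlice, represent, h, h]

lemma norm_represent_le {i I : ℍ} (hi : i ∈ imUnits) (hI : I ∈ imUnits) {G : ℂ → ℍ} {z : ℂ}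
    {C : ℝ} (h1 : ‖G z‖ ≤ C) (h2 : ‖G (starRingEnd ℂ z)‖ ≤ C) :
    ‖represent i I G z‖ ≤ 2 * C := by
  have hIi : ‖I * i‖ = 1 := by rw [norm_mul, hi.2, hI.2, one_mul]
  have ha : ‖(1 : ℍ) + I * i‖ ≤ 2 := (norm_add_le _ _).trans (by rw [hIi, norm_one]; norm_num)
  have hb : ‖(1 : ℍ) - I * i‖ ≤ 2 := (norm_sub_le _ _).trans (by rw [hIi, norm_one]; norm_num)
  rw [represent, norm_smul, Real.norm_of_nonneg (by norm_num)]
  have hs := norm_add_le ((1 + I * i) * G (starRingEnd ℂ z)) ((1 - I * i) * G z)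
  rw [norm_mul, norm_mul] at hs
  have h3 : ‖(1 : ℍ) + I * i‖ * ‖G (starRingEnd ℂ z)‖ ≤ 2 * C := by gcongr
  have h4 : ‖(1 : ℍ) - I * i‖ * ‖G z‖ ≤ 2 * C := by gcongr
  linarith

lemma norm_kernelOnSlice_le {i I : ℍ} (hi : i ∈ imUnits) (hI : I ∈ imUnits) {z ζ : ℂ} {ρ : ℝ}
    (hρ : ρ < 1) (hz : ‖z‖ ≤ ρ) (hζ : ζ ∈ disc) :
    ‖kernelOnSlice i I z ζ‖ ≤ 2 * (Real.pi⁻¹ * ((1 - ρ) ^ 2)⁻¹) := by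
  refine norm_represent_le hi hI ?_ ?_
  · rw [norm_toSlice hi]
    exact norm_complexBergman_le hρ hz hζ
  · rw [norm_toSlice hi]
    exact norm_complexBergman_le hρ (by rwa [RCLike.norm_conj]) hζ

lemma stronglyMeasurable_kernelOnSlice (i I : ℍ) {X : Type*} [MeasurableSpace X] {u v : X → ℂ}
    (hu : Measurable u) (hv : Measurable v) :
    StronglyMeasurable fun x => kernelOnSlice i I (u x) (v x) := by
  have h1 : StronglyMeasurable fun x => complexBergman (u x) (v x) :=
    (measurable_complexBergman.comp (hu.prodMk hv)).stronglyMeasurable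
  have h2 : StronglyMeasurable fun x => complexBergman (starRingEnd ℂ (u x)) (v x) :=
    (measurable_complexBergman.comp
      ((Complex.continuous_conj.measurable.comp hu).prodMk hv)).stronglyMeasurable
  exact ((stronglyMeasurable_const.mul ((continuous_toSlice i).comp_stronglyMeasurable h2)).add
    (stronglyMeasurable_const.mul ((continuous_toSlice i).comp_stronglyMeasurable h1))).const_smul
      (2⁻¹ : ℝ)

lemma bergmanSpace.integrableOn {i : ℍ} (hi : i ∈ imUnits) {g : ℍ → ℍ} (hg : g ∈ bergmanSpace i) :
    IntegrableOn (fun z => g (toSlice i z)) disc := by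
  have hc : ContinuousOn (fun z => g (toSlice i z)) disc := fun z hz =>
    (hg.1.hasSliceDerivAt hi hz).continuousAt.continuousWithinAt
  have h2 := (memLp_two_iff_integrable_sq_norm
    (hc.aestronglyMeasurable Metric.isOpen_ball.measurableSet)).2 hg.2
  have : IsFiniteMeasure (volume.restrict disc) :=
    isFiniteMeasure_restrict.2 measure_ball_lt_top.ne
  exact h2.integrable one_le_two

lemma integrableOn_kernelOnSlice_mul {i I : ℍ} (hi : i ∈ imUnits) (hI : I ∈ imUnits) {G : ℂ → ℍ}
    (hG : IntegrableOn G disc) {z : ℂ} (hz : z ∈ disc) :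
    IntegrableOn (fun ζ => kernelOnSlice i I z ζ * G ζ) disc := by
  have hz1 : ‖z‖ < 1 := by simpa using hz
  refine Integrable.bdd_mul hG
    (stronglyMeasurable_kernelOnSlice i I measurable_const measurable_id).aestronglyMeasurable ?_ (c := 2 * (Real.pi⁻¹ * ((1 - ‖z‖) ^ 2)⁻¹))
  filter_upwards [ae_restrict_mem Metric.isOpen_ball.measurableSet] with ζ hζ
  exact norm_kernelOnSlice_le hi hI hz1 le_rfl hζ

/-- The reproducing property of the Bergman kernel on the slice of `i`, for `ℍ`-valued functions,
obtained from the scalar one through the functionals `coord i p`. -/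
lemma integral_toSlice_complexBergman_mul {i : ℍ} (hi : i ∈ imUnits) {g : ℍ → ℍ}
    (hg : g ∈ bergmanSpace i) {z : ℂ} (hz : z ∈ disc) :
    IntegrableOn (fun ζ => toSlice i (complexBergman z ζ) * g (toSlice i ζ)) disc ∧
      ∫ ζ in disc, toSlice i (complexBergman z ζ) * g (toSlice i ζ) = g (toSlice i z) := by
  have hz1 : ‖z‖ < 1 := by simpa using hz
  have hG := bergmanSpace.integrableOn hi hg
  have hint : IntegrableOn (fun ζ => toSlice i (complexBergman z ζ) * g (toSlice i ζ)) disc := by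
    refine Integrable.bdd_mul hG ((continuous_toSlice i).comp_aestronglyMeasurable
      (measurable_complexBergman.comp measurable_prodMk_left).aestronglyMeasurable) ?_
      (c := Real.pi⁻¹ * ((1 - ‖z‖) ^ 2)⁻¹)
    filter_upwards [ae_restrict_mem Metric.isOpen_ball.measurableSet] with ζ hζ
    rw [norm_toSlice hi]
    exact norm_complexBergman_le hz1 le_rfl hζ
  refine ⟨hint, ext_coord i fun p => ?_⟩
  rw [← ContinuousLinearMap.integral_comp_comm _ hint]
  simp only [coord_toSlice_mul hi]
  refine integral_complexBergman_mul (g := fun ζ => coord i p (g (toSlice i ζ)))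
    (fun w hw => ?_) ((coord i p).integrable_comp hG) hz
  exact ((hg.1.hasSliceDerivAt hi hw).hasDerivAt_coord hi p).differentiableAt.differentiableWithinAt

lemma integral_kernelOnSlice_mul {i I : ℍ} (hi : i ∈ imUnits) (hI : I ∈ imUnits) {g : ℍ → ℍ}
    (hg : g ∈ bergmanSpace i) {z : ℂ} (hz : z ∈ disc) :
    ∫ ζ in disc, kernelOnSlice i I z ζ * g (toSlice i ζ) = g (toSlice I z) := by
  obtain ⟨h1, e1⟩ := integral_toSlice_complexBergman_mul hi hg hz
  obtain ⟨h2, e2⟩ := integral_toSlice_complexBergman_mul hi hg (conj_mem_disc hz)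
  have e : ∀ ζ, kernelOnSlice i I z ζ * g (toSlice i ζ) = (2⁻¹ : ℝ) •
      ((1 + I * i) * (toSlice i (complexBergman (starRingEnd ℂ z) ζ) * g (toSlice i ζ)) +
        (1 - I * i) * (toSlice i (complexBergman z ζ) * g (toSlice i ζ))) := fun ζ => by
    rw [kernelOnSlice, represent, smul_mul_assoc, add_mul, mul_assoc, mul_assoc]
  simp only [e]
  rw [integral_smul, integral_add (h2.const_mul _) (h1.const_mul _),
    integral_const_mul_of_integrable h2, integral_const_mul_of_integrable h1, e1, e2,
    hg.1.eq_represent hi hI hz, represent]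

lemma ae_mem_slitDisc : ∀ᵐ z : ℂ ∂(volume.restrict disc), z ∈ slitDisc := by
  have hnull : volume ((LinearMap.ker Complex.imLm : Submodule ℝ ℂ) : Set ℂ) = 0 := by
    refine Measure.addHaar_submodule _ _ fun h => ?_
    have : Complex.I ∈ LinearMap.ker Complex.imLm := h ▸ Submodule.mem_top
    simp at this
  have h : ∀ᵐ z : ℂ ∂(volume.restrict disc), z ∉ (LinearMap.ker Complex.imLm : Submodule ℝ ℂ) :=
    ae_restrict_of_ae (measure_eq_zero_iff_ae_notMem.1 hnull)
  filter_upwards [h, ae_restrict_mem Metric.isOpen_ball.measurableSet] with z hz hz'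
  exact ⟨hz', Complex.mem_slitPlane_iff.2 (Or.inr fun h0 => hz h0)⟩

/-- If `(1 - σ) f + σ φ'⁻¹ f'`, with `φ(z) = e_k(z^α)`, agrees on the slice of `i` with a slice
regular function, it agrees with it on all slices. -/
lemma eq_add_of_eqOn_slice {σ α : ℝ} {k : ℕ∞} {i I : ℍ} (hi : i ∈ imUnits) (hI : I ∈ imUnits)
    {f g : ℍ → ℍ} (hf : SliceRegularOn f unitBall) (hg : SliceRegularOn g unitBall)
    (h : ∀ z ∈ slitDisc, g (toSlice i z) = (1 - σ) • f (toSlice i z) +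
      σ • (toSlice i (complexMeasureDeriv α k z)⁻¹ * cullenDeriv f (toSlice i z)))
    {z : ℂ} (hz : z ∈ slitDisc) :
    g (toSlice I z) = (1 - σ) • f (toSlice I z) +
      σ • (toSlice I (complexMeasureDeriv α k z)⁻¹ * cullenDeriv f (toSlice I z)) := by
  have hz' := conj_mem_slitDisc hz
  have hconj := (intrinsicOn_starMul_deriv α k).map_conj (fun z => conj_mem_slitDisc) hi hz
  rw [hg.eq_represent hi hI hz.1, hf.eq_represent hi hI hz.1,
    hf.cullenDeriv_eq_represent hi hI hz.1]
  simp only [represent, h z hz, h _ hz', hconj, ← map_inv₀]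
  have h1 := toSlice_intertwine_add hi hI (complexMeasureDeriv α k z)⁻¹
  have h2 := toSlice_intertwine_sub hi hI (complexMeasureDeriv α k z)⁻¹
  generalize (1 : ℍ) + I * i = a at h1 ⊢
  generalize (1 : ℍ) - I * i = b at h2 ⊢
  simp only [mul_add, mul_smul_comm, ← mul_assoc, h1, h2]
  module

/-! ### Integration along Lipschitz paths -/

/-- The fundamental theorem of calculus for a holomorphic function along a Lipschitz path. -/
lemma integral_deriv_comp_lipschitz {U : Set ℂ} (hU : IsOpen U) {h : ℂ → ℂ}
    (hh : DifferentiableOn ℂ h U) {z : ℝ → ℂ} {K : NNReal} (hz : LipschitzWith K z)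
    (hzU : ∀ t, z t ∈ U) :
    ∫ t in (0 : ℝ)..1, (deriv z t * deriv h (z t)).re = (h (z 1)).re - (h (z 0)).re := by
  obtain ⟨M, hM⟩ : ∃ M, LipschitzOnWith M h (z '' Set.Icc 0 1) := by
    refine LocallyLipschitzOn.exists_lipschitzOnWith_of_compact
      (isCompact_Icc.image hz.continuous) ?_
    rintro _ ⟨t, -, rfl⟩
    have h1 : ContDiffAt ℂ 1 h (z t) :=
      (hh.contDiffOn hU).contDiffAt (hU.mem_nhds (hzU t))
    obtain ⟨M, s, hs, hM⟩ := h1.exists_lipschitzOnWith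
    exact ⟨M, s, mem_nhdsWithin_of_mem_nhds hs, hM⟩
  have hR : LipschitzOnWith (1 * (M * K)) (fun t => (h (z t)).re) (Set.uIcc 0 1) := by
    rw [Set.uIcc_of_le zero_le_one]
    have h1 : LipschitzOnWith (M * K) (fun t => h (z t)) (Set.Icc 0 1) :=
      hM.comp hz.lipschitzOnWith (Set.mapsTo_image _ _)
    have h2 : LipschitzWith 1 Complex.re :=
      LipschitzWith.of_dist_le_mul fun a b => by
        rw [NNReal.coe_one, one_mul, dist_eq_norm, dist_eq_norm, ← Complex.sub_re]
        exact Complex.abs_re_le_norm _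
    exact h2.comp_lipschitzOnWith h1
  rw [← hR.absolutelyContinuousOnInterval.integral_deriv_eq_sub]
  refine intervalIntegral.integral_congr_ae ?_
  filter_upwards [hz.ae_differentiableAt_real] with t ht _
  have h1 : HasDerivAt (fun t => h (z t)) (deriv z t * deriv h (z t)) t :=
    HasDerivAt.scomp t (hh.differentiableAt (hU.mem_nhds (hzU t))).hasDerivAt ht.hasDerivAt
  exact (Complex.reCLM.hasFDerivAt.comp_hasDerivAt t h1).deriv.symm

/-- A slice path is the image of a Lipschitz path in the slit disc. -/
lemma IsSlicePath.exists_lift {p q : ℍ} {γ : Path p q} (h : IsSlicePath γ) :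
    ∃ I ∈ imUnits, ∃ (z : ℝ → ℂ) (K : NNReal), LipschitzWith K z ∧ (∀ t, z t ∈ slitDisc) ∧
      (∀ t, γ.extend t = toSlice I (z t)) ∧
      ∀ t ∈ Set.Ioo (0 : ℝ) 1, derivWithin γ.extend (Set.Icc 0 1) t = toSlice I (deriv z t) := by
  obtain ⟨⟨K, hK⟩, I, hI, hγ⟩ := h
  have hex : ∀ t, γ.extend t ∈ slitSlice I := fun t =>
    hγ (Set.projIcc 0 1 zero_le_one t)
  have hlift : ∀ t, γ.extend t = toSlice I (coord I 1 (γ.extend t)) := fun t => by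
    obtain ⟨w, hw⟩ := exists_toSlice_of_mem_slicePlane (hex t).2
    rw [hw, coord_one_toSlice hI]
  have hLip : LipschitzWith (K * 1) γ.extend := hK.comp (LipschitzWith.projIcc zero_le_one)
  refine ⟨I, hI, fun t => coord I 1 (γ.extend t), _, (coord I 1).lipschitz.comp hLip,
    fun t => ?_, hlift, fun t ht => ?_⟩
  · rw [← toSlice_mem_slitBall hI, ← hlift]
    exact (hex t).1
  · rw [derivWithin_of_mem_nhds (Icc_mem_nhds ht.1 ht.2)]
    by_cases hd : DifferentiableAt ℝ γ.extend t
    · have h1 := ((coord I 1).hasFDerivAt.comp_hasDerivAt t hd.hasDerivAt)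
      have h2 := (toSliceL I).hasFDerivAt.comp_hasDerivAt t h1
      have h3 : (toSliceL I) ∘ (coord I 1) ∘ γ.extend = γ.extend := by
        ext1 s; simp [← hlift s]
      rw [h3] at h2
      rw [h2.deriv, toSliceL_apply]
      congr 1
      exact h1.deriv.symm
    · -- where the path is not differentiable, neither is its lift, and both derivatives are `0`
      have h1 : ¬ DifferentiableAt ℝ (fun t => coord I 1 (γ.extend t)) t := fun h1 => hd <| by
        have h2 := (toSliceL I).differentiableAt.comp t h1
        have h3 : (toSliceL I) ∘ (fun t => coord I 1 (γ.extend t)) = γ.extend := by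
          ext1 s; simp [← hlift s]
        rwa [h3] at h2
      rw [deriv_zero_of_not_differentiableAt hd, deriv_zero_of_not_differentiableAt h1,
        toSlice_zero]

/-- Fubini's theorem for the integral of the Bergman kernel along a path, against an element of the
Bergman space. -/
lemma integral_path_kernel {i I : ℍ} (hi : i ∈ imUnits) (hI : I ∈ imUnits) {g : ℍ → ℍ}
    (hg : g ∈ bergmanSpace i) {z : ℝ → ℂ} (hz : Continuous z) (hzd : ∀ t, z t ∈ disc)
    {b : ℝ → ℍ} (hb : StronglyMeasurable b) {M : ℝ} (hM : ∀ t ∈ Set.Ioc (0 : ℝ) 1, ‖b t‖ ≤ M) :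
    (∀ ζ ∈ disc, IntervalIntegrable (fun t => b t * kernelOnSlice i I (z t) ζ) volume 0 1) ∧
    IntegrableOn (fun ζ => (∫ t in (0 : ℝ)..1, b t * kernelOnSlice i I (z t) ζ) *
      g (toSlice i ζ)) disc ∧
    IntervalIntegrable (fun t => b t * g (toSlice I (z t))) volume 0 1 ∧
    ∫ ζ in disc, (∫ t in (0 : ℝ)..1, b t * kernelOnSlice i I (z t) ζ) * g (toSlice i ζ) =
      ∫ t in (0 : ℝ)..1, b t * g (toSlice I (z t)) := by
  obtain ⟨ρ, hρ, hzρ⟩ : ∃ ρ < 1, ∀ t ∈ Set.Icc (0 : ℝ) 1, ‖z t‖ ≤ ρ := by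
    obtain ⟨t₀, -, h₀⟩ := isCompact_Icc.exists_isMaxOn (Set.nonempty_Icc.2 zero_le_one)
      (hz.norm.continuousOn (s := Set.Icc (0 : ℝ) 1))
    exact ⟨‖z t₀‖, by simpa using hzd t₀, fun t ht => h₀ ht⟩
  have hM0 : 0 ≤ M := (norm_nonneg _).trans (hM 1 (by simp))
  set C : ℝ := M * (2 * (Real.pi⁻¹ * ((1 - ρ) ^ 2)⁻¹)) with hC
  have hbound : ∀ t ∈ Set.Ioc (0 : ℝ) 1, ∀ ζ ∈ disc, ‖b t * kernelOnSlice i I (z t) ζ‖ ≤ C := by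
    intro t ht ζ hζ
    rw [norm_mul]
    exact mul_le_mul (hM t ht) (norm_kernelOnSlice_le hi hI hρ (hzρ t ⟨ht.1.le, ht.2⟩) hζ)
      (norm_nonneg _) hM0
  set μ : Measure ℂ := volume.restrict disc with hμ
  set ν : Measure ℝ := volume.restrict (Set.Ioc 0 1) with hν
  have : IsFiniteMeasure μ := isFiniteMeasure_restrict.2 measure_ball_lt_top.ne
  have hG : Integrable (fun ζ => g (toSlice i ζ)) μ := bergmanSpace.integrableOn hi hg
  have hker : StronglyMeasurable fun p : ℂ × ℝ => kernelOnSlice i I (z p.2) p.1 :=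
    stronglyMeasurable_kernelOnSlice i I (hz.measurable.comp measurable_snd) measurable_fst
  have hbm : StronglyMeasurable fun p : ℂ × ℝ => b p.2 := hb.comp_measurable measurable_snd
  have hmeas : StronglyMeasurable fun p : ℂ × ℝ => b p.2 * kernelOnSlice i I (z p.2) p.1 :=
    hbm.mul hker
  have hint1 : ∀ ζ ∈ disc, Integrable (fun t => b t * kernelOnSlice i I (z t) ζ) ν := by
    intro ζ hζ
    have hm : StronglyMeasurable fun t => b t * kernelOnSlice i I (z t) ζ :=
      hmeas.comp_measurable (measurable_prodMk_left (x := ζ))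
    refine Integrable.of_bound hm.aestronglyMeasurable C ?_
    filter_upwards [ae_restrict_mem measurableSet_Ioc] with t ht
    exact hbound t ht ζ hζ
  have hmem : ∀ᵐ p : ℂ × ℝ ∂(μ.prod ν), p.1 ∈ disc ∧ p.2 ∈ Set.Ioc (0 : ℝ) 1 := by
    rw [hμ, hν, Measure.prod_restrict]
    filter_upwards [ae_restrict_mem
      (Metric.isOpen_ball.measurableSet.prod measurableSet_Ioc)] with p hp
    exact hp
  have hprod : Integrable (fun p : ℂ × ℝ =>
      b p.2 * kernelOnSlice i I (z p.2) p.1 * g (toSlice i p.1)) (μ.prod ν) := by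
    have hbd : ∀ᵐ p : ℂ × ℝ ∂(μ.prod ν), ‖b p.2 * kernelOnSlice i I (z p.2) p.1‖ ≤ C := by
      filter_upwards [hmem] with p hp
      exact hbound p.2 hp.2 p.1 hp.1
    exact Integrable.bdd_mul (hG.comp_fst ν) hmeas.aestronglyMeasurable hbd
  have hinner : ∀ ζ ∈ disc, ∫ t, b t * kernelOnSlice i I (z t) ζ * g (toSlice i ζ) ∂ν =
      (∫ t, b t * kernelOnSlice i I (z t) ζ ∂ν) * g (toSlice i ζ) := fun ζ hζ =>
    integral_mul_const_of_integrable (hint1 ζ hζ)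
  have hinner_ae : (fun ζ => ∫ t, b t * kernelOnSlice i I (z t) ζ * g (toSlice i ζ) ∂ν) =ᵐ[μ]
      fun ζ => (∫ t, b t * kernelOnSlice i I (z t) ζ ∂ν) * g (toSlice i ζ) := by
    filter_upwards [ae_restrict_mem Metric.isOpen_ball.measurableSet] with ζ hζ
    exact hinner ζ hζ
  have houter : ∀ t, ∫ ζ, b t * kernelOnSlice i I (z t) ζ * g (toSlice i ζ) ∂μ =
      b t * g (toSlice I (z t)) := fun t => by
    simp only [mul_assoc]
    rw [integral_const_mul_of_integrable
      (integrableOn_kernelOnSlice_mul hi hI (bergmanSpace.integrableOn hi hg) (hzd t)),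
      integral_kernelOnSlice_mul hi hI hg (hzd t)]
  simp only [intervalIntegrable_iff_integrableOn_Ioc_of_le zero_le_one,
    intervalIntegral.integral_of_le zero_le_one]
  refine ⟨hint1, hprod.integral_prod_left.congr hinner_ae, ?_, ?_⟩
  · refine hprod.integral_prod_right.congr (Filter.Eventually.of_forall fun t => ?_)
    exact houter t
  · rw [← integral_congr_ae hinner_ae, integral_integral_swap hprod]
    exact integral_congr_ae (Filter.Eventually.of_forall houter)

/-- The coefficient `σ⁻¹ exp[(1-σ)/σ φ(w)] φ'(w)` of the 1-form defining the kernel, with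
`φ(w) = e_k(w^α)`, as a complex function. -/
noncomputable def formCoeff (σ α : ℝ) (k : ℕ∞) (w : ℂ) : ℂ :=
  σ⁻¹ • (Complex.exp (((1 - σ) / σ : ℝ) * complexMeasure α k w) * complexMeasureDeriv α k w)

lemma continuousOn_formCoeff (σ α : ℝ) {k : ℕ∞} (hk : 1 ≤ k) :
    ContinuousOn (formCoeff σ α k) slitDisc := by
  have hd : DifferentiableOn ℂ (complexMeasure α k) slitDisc := fun w hw =>
    (hasDerivAt_complexMeasure α hk hw.2).differentiableAt.differentiableWithinAt
  have hd' : ContinuousOn (complexMeasureDeriv α k) slitDisc :=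
    (hd.deriv isOpen_slitDisc).continuousOn.congr fun w hw =>
      (hasDerivAt_complexMeasure α hk hw.2).deriv.symm
  exact ((Complex.continuous_exp.comp_continuousOn
    (continuousOn_const.mul hd.continuousOn)).mul hd').const_smul σ⁻¹

/-- Along a lifted slice path, the 1-form of the kernel is the kernel multiplied from the left by
an element of the slice. -/
lemma curveIntegralFun_kernelForm {σ α : ℝ} {k : ℕ∞} (hk : 1 ≤ k) {i I : ℍ} (hi : i ∈ imUnits)
    (hI : I ∈ imUnits) {p q : ℍ} {γ : Path p q} {z : ℝ → ℂ} (hz : ∀ t, z t ∈ slitDisc)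
    (hγ : ∀ t, γ.extend t = toSlice I (z t))
    (hγ' : ∀ t ∈ Set.Ioo (0 : ℝ) 1,
      derivWithin γ.extend (Set.Icc 0 1) t = toSlice I (deriv z t)) (ζ : ℂ)
    {t : ℝ} (ht : t ∈ Set.Ioo (0 : ℝ) 1) :
    curveIntegralFun (kernelForm σ α k i (toSlice i ζ)) γ t =
      toSlice I (formCoeff σ α k (z t) * deriv z t) * kernelOnSlice i I (z t) ζ := by
  have h1 := intrinsicOn_exp_smul_fractalMeasure ((1 - σ) / σ) α k I hI _ (hz t)
  beta_reduce at h1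
  rw [curveIntegralFun_def, hγ, hγ' t ht, kernelForm, ContinuousLinearMap.mulLeftRight_apply, h1,
    cullenDeriv_fractalMeasure α hk I hI _ (hz t), sliceBergmanKernel_toSlice hi hI,
    ← toSlice_mul hI, ← toSlice_smul, ← toSlice_mul hI, formCoeff]

/-- The form `σ⁻¹ exp(c φ) φ' ((1-σ) f + σ φ'⁻¹ f')`, with `c = (1-σ)/σ`, is the derivative of
`exp(c φ) f`; its integral along a path is the difference of the boundary values. -/
lemma integral_formCoeff_mul {σ α : ℝ} (hσ : 0 < σ) {k : ℕ∞} (hk : 1 ≤ k) {I : ℍ}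
    (hI : I ∈ imUnits) {f g : ℍ → ℍ} (hf : SliceRegularOn f unitBall)
    (hne : ∀ z ∈ slitDisc, complexMeasureDeriv α k z ≠ 0)
    (hg : ∀ z ∈ slitDisc, g (toSlice I z) = (1 - σ) • f (toSlice I z) +
      σ • (toSlice I (complexMeasureDeriv α k z)⁻¹ * cullenDeriv f (toSlice I z)))
    {z : ℝ → ℂ} {K : NNReal} (hK : LipschitzWith K z) (hz : ∀ t, z t ∈ slitDisc)
    (hint : IntervalIntegrable
      (fun t => toSlice I (formCoeff σ α k (z t) * deriv z t) * g (toSlice I (z t))) volume 0 1) :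
    ∫ t in (0 : ℝ)..1, toSlice I (formCoeff σ α k (z t) * deriv z t) * g (toSlice I (z t)) =
      toSlice I (Complex.exp (((1 - σ) / σ : ℝ) * complexMeasure α k (z 1))) *
        f (toSlice I (z 1)) -
      toSlice I (Complex.exp (((1 - σ) / σ : ℝ) * complexMeasure α k (z 0))) *
        f (toSlice I (z 0)) := by
  refine ext_coord_re I fun p => ?_
  have hH : ∀ w ∈ slitDisc, HasDerivAt
      (fun w => Complex.exp (((1 - σ) / σ : ℝ) * complexMeasure α k w) *
        coord I p (f (toSlice I w)))
      (formCoeff σ α k w * coord I p (g (toSlice I w))) w := by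
    intro w hw
    have h1 := ((hasDerivAt_complexMeasure α hk hw.2).const_mul
      (((1 - σ) / σ : ℝ) : ℂ)).cexp.mul ((hf.hasSliceDerivAt hI hw.1).hasDerivAt_coord hI p)
    refine h1.congr_deriv ?_
    have hσ0 : (σ : ℂ) ≠ 0 := by exact_mod_cast hσ.ne'
    have h0 := hne w hw
    rw [hg w hw, map_add, map_smul, map_smul, coord_toSlice_mul hI, formCoeff]
    simp only [Complex.real_smul]
    push_cast
    field_simp
  have hFTC := integral_deriv_comp_lipschitz isOpen_slitDisc
    (fun w hw => (hH w hw).differentiableAt.differentiableWithinAt) hK hz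
  rw [map_sub, Complex.sub_re, coord_toSlice_mul hI, coord_toSlice_mul hI, ← hFTC]
  have hcomm := (Complex.reCLM.comp (coord I p)).intervalIntegral_comp_comm hint
  refine Eq.trans hcomm.symm (intervalIntegral.integral_congr fun t _ => ?_)
  simp only [ContinuousLinearMap.comp_apply, Complex.reCLM_apply, coord_toSlice_mul hI,
    (hH _ (hz t)).deriv]
  congr 1
  ring

end SliceFractal

open SliceFractal MeasureTheory in
theorem mainTheorem9
    (σ α : ℝ) (hσ : σ ∈ Set.Ioo (0 : ℝ) 1) (hα : α ∈ Set.Ioc (0 : ℝ) 1)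
    (k : ℕ∞) (hk : 1 ≤ k)
    (hne : ∀ q ∈ SliceFractal.slitBall, SliceFractal.fractalMeasure α (k - 1) q ≠ 0)
    (i : ℍ) (hi : i ∈ SliceFractal.imUnits)
    (f : ℍ → ℍ) (hf : SliceFractal.SliceRegularOn f SliceFractal.unitBall)
    (hB : SliceFractal.MemBergman i (SliceFractal.ffDeriv σ α k i f)) :
    (∀ q ∈ SliceFractal.slitBall,
      MeasureTheory.IntegrableOn
        (fun z : ℂ => SliceFractal.sliceBergmanKernel i q (SliceFractal.toSlice i z) *
          SliceFractal.ffDeriv σ α k i f (SliceFractal.toSlice i z)) (Metric.ball 0 1) ∧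
      f q = -((σ / (1 - σ)) • SliceFractal.starMul
            (SliceFractal.starInv (SliceFractal.starMul
              (fun p => α • SliceFractal.qpow p (α - 1))
              (SliceFractal.fractalMeasure α (k - 1))))
            (SliceFractal.cullenDeriv f) q) +
          (1 / (1 - σ)) • ∫ z : ℂ in Metric.ball 0 1,
            SliceFractal.sliceBergmanKernel i q (SliceFractal.toSlice i z) *
              SliceFractal.ffDeriv σ α k i f (SliceFractal.toSlice i z)) ∧
    (∀ γ : ∀ q : ℍ, Path (((1 / 2 : ℝ) : ℍ)) q,
      (∀ q ∈ SliceFractal.slitBall, SliceFractal.IsSlicePath (γ q)) →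
      ∀ q ∈ SliceFractal.slitBall,
        (∀ ζ ∈ SliceFractal.unitBall ∩ SliceFractal.slicePlane i,
          CurveIntegrable (SliceFractal.kernelForm σ α k i ζ) (γ q)) ∧
        MeasureTheory.IntegrableOn
          (fun z : ℂ => SliceFractal.halfKernel σ α k i γ q (SliceFractal.toSlice i z) *
            SliceFractal.ffDeriv σ α k i f (SliceFractal.toSlice i z)) (Metric.ball 0 1) ∧
        f q = NormedSpace.exp (((1 - σ) / σ) •
              (SliceFractal.fractalMeasure α k ((1 / 2 : ℝ) : ℍ) -
                SliceFractal.fractalMeasure α k q)) * f ((1 / 2 : ℝ) : ℍ) +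
            ∫ z : ℂ in Metric.ball 0 1,
              SliceFractal.halfKernel σ α k i γ q (SliceFractal.toSlice i z) *
                SliceFractal.ffDeriv σ α k i f (SliceFractal.toSlice i z)) := by
  obtain ⟨hσ0, hσ1⟩ := hσ
  have h1σ : (1 - σ) ≠ 0 := by linarith
  obtain ⟨g, hg, hgEq⟩ := hB
  have hne' : ∀ z ∈ slitDisc, complexMeasureDeriv α k z ≠ 0 := fun z hz =>
    complexMeasureDeriv_ne_zero hα.1 hne hi hz
  have hgi : ∀ z ∈ slitDisc, ffDeriv σ α k i f (toSlice i z) = g (toSlice i z) := fun z hz =>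
    hgEq ⟨(toSlice_mem_slitBall hi).2 hz, toSlice_mem_slicePlane i z⟩
  have hgI : ∀ I ∈ imUnits, ∀ z ∈ slitDisc, g (toSlice I z) = (1 - σ) • f (toSlice I z) +
      σ • (toSlice I (complexMeasureDeriv α k z)⁻¹ * cullenDeriv f (toSlice I z)) :=
    fun I hI z hz => eq_add_of_eqOn_slice hi hI hf hg.1
      (fun w hw => by rw [← hgi w hw, ffDeriv_toSlice σ hk hi hf hw (hne' w hw)]) hz
  -- the slit is a null set, so under the integrals `ffDeriv` may be replaced by `g`
  have hae : ∀ u : ℂ → ℍ, (fun ζ => u ζ * ffDeriv σ α k i f (toSlice i ζ))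
      =ᵐ[volume.restrict disc] fun ζ => u ζ * g (toSlice i ζ) := fun u => by
    filter_upwards [ae_mem_slitDisc] with ζ hζ
    rw [hgi ζ hζ]
  have hG := bergmanSpace.integrableOn hi hg
  refine ⟨fun q hq => ?_, fun γ hγ q hq => ?_⟩
  · obtain ⟨I, hI, z, rfl⟩ := exists_eq_toSlice q
    have hz := (toSlice_mem_slitBall hI).1 hq
    have hker : ∀ ζ, sliceBergmanKernel i (toSlice I z) (toSlice i ζ) = kernelOnSlice i I z ζ :=
      fun ζ => sliceBergmanKernel_toSlice hi hI z ζ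
    simp only [hker]
    refine ⟨(integrableOn_kernelOnSlice_mul hi hI hG hz.1).congr (hae _).symm, ?_⟩
    have hinv := (intrinsicOn_starMul_deriv α k).starInv fun z => conj_mem_slitDisc
    rw [integral_congr_ae (hae _), integral_kernelOnSlice_mul hi hI hg hz.1, hgI I hI z hz,
      hinv.starMul_eq (fun z => conj_mem_slitDisc) hI hz, hinv I hI z hz, smul_add, smul_smul,
      smul_smul, one_div_mul_cancel h1σ, one_smul, one_div_mul_eq_div]
    abel
  · obtain ⟨I, hI, z, K, hK, hz, hγz, hγz'⟩ := (hγ q hq).exists_lift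
    have hz0 : ((1 / 2 : ℝ) : ℍ) = toSlice I (z 0) := by rw [← hγz, Path.extend_zero]
    have hz1 : q = toSlice I (z 1) := by rw [← hγz, Path.extend_one]
    set b : ℝ → ℍ := fun t => toSlice I (formCoeff σ α k (z t) * deriv z t) with hb
    have hA : Continuous fun t => formCoeff σ α k (z t) :=
      (continuousOn_formCoeff σ α hk).comp_continuous hK.continuous hz
    have hbm : StronglyMeasurable b := (continuous_toSlice I).comp_stronglyMeasurable
      (hA.stronglyMeasurable.mul (stronglyMeasurable_deriv z))
    obtain ⟨M, hM⟩ := (isCompact_Icc (a := (0 : ℝ)) (b := 1)).exists_bound_of_continuousOn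
      hA.continuousOn
    have hbM : ∀ t ∈ Set.Ioc (0 : ℝ) 1, ‖b t‖ ≤ M * K := fun t ht => by
      have h1 := hM t ⟨ht.1.le, ht.2⟩
      rw [hb, norm_toSlice hI, norm_mul]
      exact mul_le_mul h1 (norm_deriv_le_of_lipschitz hK) (norm_nonneg _)
        ((norm_nonneg _).trans h1)
    obtain ⟨hF1, hF2, hF3, hF4⟩ :=
      integral_path_kernel hi hI hg hK.continuous (fun t => (hz t).1) hbm hbM
    have hcurve : ∀ ζ, ∀ t ∈ Set.Ioo (0 : ℝ) 1,
        curveIntegralFun (kernelForm σ α k i (toSlice i ζ)) (γ q) t =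
          b t * kernelOnSlice i I (z t) ζ := fun ζ t ht =>
      curveIntegralFun_kernelForm hk hi hI hz hγz hγz' ζ ht
    have hcurveInt : ∀ ζ, curveIntegral (kernelForm σ α k i (toSlice i ζ)) (γ q) =
        ∫ t in (0 : ℝ)..1, b t * kernelOnSlice i I (z t) ζ := fun ζ => by
      rw [curveIntegral_def, intervalIntegral.integral_of_le zero_le_one,
        intervalIntegral.integral_of_le zero_le_one, integral_Ioc_eq_integral_Ioo,
        integral_Ioc_eq_integral_Ioo]
      exact setIntegral_congr_fun measurableSet_Ioo (hcurve ζ)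
    have hE := intrinsicOn_exp_smul_fractalMeasure ((σ - 1) / σ) α k
    set e : ℍ := toSlice I (Complex.exp (((σ - 1) / σ : ℝ) * complexMeasure α k (z 1))) with he
    -- the exponential factor is intrinsic, so the value of the `*`-product at `q` involves only
    -- the path `γ q`, and not the unrelated path `γ (star q)`
    have hhalf : ∀ ζ, halfKernel σ α k i γ q (toSlice i ζ) =
        e * ∫ t in (0 : ℝ)..1, b t * kernelOnSlice i I (z t) ζ := fun ζ => by
      have h1 := hE.starMul_eq (fun z => conj_mem_slitDisc) hI (hz 1)
        (fun p => curveIntegral (kernelForm σ α k i (toSlice i ζ)) (γ p))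
      rw [← hz1] at h1
      rw [halfKernel, h1, hcurveInt, he, ← hE I hI _ (hz 1), ← hz1]
    refine ⟨fun ζ hζ => ?_, ?_, ?_⟩
    · obtain ⟨w, rfl⟩ := exists_toSlice_of_mem_slicePlane hζ.2
      have h1 := hF1 w ((toSlice_mem_unitBall hi).1 hζ.1)
      rw [CurveIntegrable]
      rw [intervalIntegrable_iff_integrableOn_Ioo_of_le zero_le_one] at h1 ⊢
      exact h1.congr_fun (fun t ht => (hcurve w t ht).symm) measurableSet_Ioo
    · simp only [hhalf]
      refine Integrable.congr ?_ (hae _).symm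
      simp only [mul_assoc e]
      exact hF2.const_mul e
    · have hφ := intrinsicOn_fractalMeasure α k I hI
      have hFTC := integral_formCoeff_mul hσ0 hk hI hf hne' (hgI I hI) hK hz hF3
      simp only [hhalf]
      rw [integral_congr_ae (hae _)]
      simp only [mul_assoc e]
      rw [integral_const_mul_of_integrable hF2, hF4, hFTC, hz0, hz1, hφ _ (hz 0), hφ _ (hz 1),
        ← toSlice_sub, ← toSlice_smul, ← toSlice_exp hI, mul_sub, ← mul_assoc, ← mul_assoc, he,
        ← toSlice_mul hI, ← toSlice_mul hI, ← Complex.exp_add, ← Complex.exp_add, ← add_mul]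
      have h1 : (((σ - 1) / σ : ℝ) : ℂ) = -(((1 - σ) / σ : ℝ) : ℂ) := by
        rw [← Complex.ofReal_neg, ← neg_div, neg_sub]
      rw [h1, neg_mul, neg_add_cancel, zero_mul, Complex.exp_zero, toSlice_one, one_mul,
        Complex.real_smul, mul_sub,
        neg_add_eq_sub (_ * complexMeasure α k (z 1)) (_ * complexMeasure α k (z 0))]
      abel
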